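/- Let $\alpha\in\{0,1\}$ and let $F_*$ be a probability distribution on $\mathbb N=\{0,1,2,\dots\}$ with finite mean $m=\sum_k kF_*(k)$ and $F_*\neq\delta_0$ (so $0<m<\infty$). Let $F$ be the distribution on $\mathbb N$ given by $F(k-1)=kF_*(k)/m$, $k\ge 1$. Let $T$ be a Galton--Watson tree with degree distribution $F_*$, i.e. the random rooted tree in which all vertices have independent numbers of children, the root having offspring distribution $F_*$ and every other vertex having offspring distribution $F$. Let $T_n$ be the finite tree obtained by stopping $T$ at generation $n$ (keeping the vertices at distance at most $n$ from the root $1$). Let $A(T_n)$ be the adjacency matrix of $T_n$, $D(T_n)$ the diagonal matrix of the degrees in $T_n$, and $\Delta(T_n)=A(T_n)-\alpha D(T_n)$. For $z\in\mathbb C_+=\{z\in\mathbb C:\Im z>0\}$ put $$X^{(n)}(z)=\big((\Delta(T_n)-zI)^{-1}\big)_{11}.$$ Let $\mathcal H$ be the set of holomorphic functions $f:\mathbb C_+\to\mathbb C_+$ with $|f(z)|\le 1/\Im z$ for all $z \in \mathbb C_+$, with the Borel $\sigma$-algebra of uniform convergence on compact sets (equivalently, the $\sigma$-algebra generated by the evaluations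 $f\mapsto f(z)$). Then: (a) there is exactly one probability measure $Q$ on $\mathcal H$ which solves the recursive distributional equation $$Y(\cdot)\ \stackrel{d}{=}\ -\Big(\,\cdot\,+\alpha(N+1)+\sum_{i=1}^{N}Y_i(\cdot)\Big)^{-1}\quad\text{(equality of laws on }\mathcal H),$$ where $N$ has distribution $F$, and $Y,Y_1,Y_2,\dots$ are i.i.d. with law $Q$ and independent of $N$; (b) for every $z\in\mathbb C_+$, as $n\to\infty$, $X^{(n)}(z)$ converges in distribution to $$X(z)=-\Big(z+\alpha N_*+\sum_{i=1}^{N_*}Y_i(z)\Big)^{-1},$$ where $N_*$ has distribution $F_*$ and $Y_1,Y_2,\dots$ are i.i.d. with law $Q$ and independent of $N_*$. -/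

import Mathlib

open MeasureTheory ProbabilityTheory Filter UpperHalfPlane
open scoped ENNReal Manifold Topology

namespace GWResolvent

/-! ### The space of holomorphic functions carrying the recursive distributional equation -/

/-- The set `𝓗` of holomorphic functions `f : ℂ₊ → ℂ₊` such that `|f z| ≤ 1 / Im z`. -/
@[ext]
structure HolSpace where
  toFun : ℍ → ℂ
  holomorphic : MDifferentiable 𝓘(ℂ) 𝓘(ℂ) toFun
  im_pos : ∀ z, 0 < (toFun z).im
  norm_le : ∀ z : ℍ, ‖toFun z‖ ≤ 1 / z.im

instance : CoeFun HolSpace (fun _ => ℍ → ℂ) := ⟨HolSpace.toFun⟩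

/-- The σ-algebra on `𝓗` generated by the evaluations `f ↦ f z`. It is the Borel σ-algebra of the
(separable, metrizable) topology of uniform convergence on compact sets. -/
noncomputable instance : MeasurableSpace HolSpace :=
  MeasurableSpace.comap HolSpace.toFun MeasurableSpace.pi

theorem measurable_eval (z : ℍ) : Measurable (fun f : HolSpace => f z) :=
  (measurable_pi_apply z).comp (comap_measurable HolSpace.toFun)

theorem measurable_of_eval {β : Type*} [MeasurableSpace β] {g : β → HolSpace}
    (hg : ∀ z : ℍ, Measurable (fun b => g b z)) : Measurable g :=
  measurable_comap_iff.2 (measurable_pi_iff.2 hg)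

theorem im_le_im_denominator (a : ℝ) (n : ℕ) (h : ℕ → HolSpace) (z : ℍ) :
    z.im ≤ ((z : ℂ) + a + ∑ i ∈ Finset.range n, h i z).im := by
  have : 0 ≤ ∑ i ∈ Finset.range n, (h i z).im :=
    Finset.sum_nonneg fun i _ => ((h i).im_pos z).le
  simp only [Complex.add_im, Complex.ofReal_im, Complex.im_sum, add_zero, coe_im]
  linarith

/-- For real `a`, `n : ℕ` and `h₀, h₁, … ∈ 𝓗`, the function
`z ↦ - (z + a + h₀ z + ⋯ + h_{n-1} z)⁻¹`, as an element of `𝓗`. -/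
noncomputable def step (a : ℝ) (n : ℕ) (h : ℕ → HolSpace) : HolSpace where
  toFun z := -((z : ℂ) + a + ∑ i ∈ Finset.range n, h i z)⁻¹
  holomorphic := by
    rw [UpperHalfPlane.mdifferentiable_iff]
    have hne : ∀ w : ℂ, w ∈ {w : ℂ | 0 < w.im} →
        ((ofComplex w : ℂ) + a + ∑ i ∈ Finset.range n, h i (ofComplex w)) ≠ 0 := by
      intro w _ h0
      have h1 := im_le_im_denominator a n h (ofComplex w)
      rw [h0] at h1
      exact absurd h1 (not_le.2 (by simpa using (ofComplex w).im_pos))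
    have hz : DifferentiableOn ℂ (fun w : ℂ => (ofComplex w : ℂ)) {w | 0 < w.im} :=
      UpperHalfPlane.mdifferentiable_iff.1 mdifferentiable_coe
    have hi : ∀ i ∈ Finset.range n,
        DifferentiableOn ℂ (fun w : ℂ => h i (ofComplex w)) {w | 0 < w.im} :=
      fun i _ => UpperHalfPlane.mdifferentiable_iff.1 (h i).holomorphic
    exact (((hz.add_const _).add (DifferentiableOn.fun_sum hi)).inv hne).neg
  im_pos z := by
    have h1 := lt_of_lt_of_le z.im_pos (im_le_im_denominator a n h z)
    rw [Complex.neg_im, Complex.inv_im, neg_div, neg_neg]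
    refine div_pos h1 (Complex.normSq_pos.2 fun h0 => ?_)
    rw [h0] at h1
    simp at h1
  norm_le z := by
    rw [norm_neg, norm_inv, ← one_div]
    exact one_div_le_one_div_of_le z.im_pos
      ((im_le_im_denominator a n h z).trans
        ((le_abs_self _).trans (Complex.abs_im_le_norm _)))

theorem measurable_step (c : ℕ → ℝ) :
    Measurable (fun p : ℕ × (ℕ → HolSpace) => step (c p.1) p.1 p.2) := by
  refine measurable_of_eval fun z => ?_
  refine measurable_from_prod_countable_right fun n => ?_
  have h1 : Measurable fun h : ℕ → HolSpace => ∑ i ∈ Finset.range n, h i z :=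
    Finset.measurable_fun_sum _ fun i _ => (measurable_eval z).comp (measurable_pi_apply i)
  have h2 : Measurable fun h : ℕ → HolSpace =>
      -((z : ℂ) + (c n : ℝ) + ∑ i ∈ Finset.range n, h i z)⁻¹ :=
    (h1.const_add _).inv.neg
  exact h2

/-- The joint law, on `ℕ × 𝓗^ℕ`, of `(N, (Y_i)_i)` where `N` has law `L`, the `Y_i` are i.i.d. with
law `Q`, and `N` is independent of `(Y_i)_i`. -/
noncomputable def inputLaw (L : PMF ℕ) (Q : ProbabilityMeasure HolSpace) :
    Measure (ℕ × (ℕ → HolSpace)) :=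
  L.toMeasure.prod (Measure.infinitePi fun _ : ℕ => (Q : Measure HolSpace))

noncomputable instance (L : PMF ℕ) (Q : ProbabilityMeasure HolSpace) :
    IsProbabilityMeasure (inputLaw L Q) := by
  unfold inputLaw
  infer_instance

/-- `Q` solves the recursive distributional equation
`Y = - (z + α (N + 1) + ∑_{i ≤ N} Y_i)⁻¹` in law on `𝓗`, where `N` has law `F`, and `Y`, `Y_i` are
i.i.d. with law `Q`, independent of `N`. -/
def IsRDESolution (α : ℝ) (F : PMF ℕ) (Q : ProbabilityMeasure HolSpace) : Prop :=
  (Q : Measure HolSpace) =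
    (inputLaw F Q).map (fun p => step (α * (p.1 + 1)) p.1 p.2)

/-- The random variable `X(z) = - (z + α N_* + ∑_{i ≤ N_*} Y_i(z))⁻¹`, as a function of
`(N_*, (Y_i)_i)`. -/
noncomputable def limitX (α : ℝ) (z : ℍ) (p : ℕ × (ℕ → HolSpace)) : ℂ :=
  step (α * p.1) p.1 p.2 z

/-! ### Galton-Watson trees with a given degree distribution -/

/-- The mean `∑_k k F_*(k) ∈ [0, ∞]` of a distribution on `ℕ`. -/
noncomputable def mean (Fs : PMF ℕ) : ℝ≥0∞ := ∑' k : ℕ, (k : ℝ≥0∞) * Fs k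

/-- The offspring distribution `F` of the non-root vertices, given the degree distribution `F_*` :
`F(k - 1) = k F_*(k) / ∑_j j F_*(j)` for `k ≥ 1`. -/
noncomputable def offspringLaw (Fs : PMF ℕ) (h0 : mean Fs ≠ 0) (htop : mean Fs ≠ ∞) : PMF ℕ :=
  ⟨fun k => ((k + 1 : ℕ) : ℝ≥0∞) * Fs (k + 1) / mean Fs, by
    have h1 : ∑' k : ℕ, ((k + 1 : ℕ) : ℝ≥0∞) * Fs (k + 1) = mean Fs := by
      rw [mean, tsum_eq_zero_add' (f := fun k : ℕ => (k : ℝ≥0∞) * Fs k) ENNReal.summable]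
      simp only [Nat.cast_zero, zero_mul, zero_add]
    have h2 : ∑' k : ℕ, ((k + 1 : ℕ) : ℝ≥0∞) * Fs (k + 1) / mean Fs = 1 := by
      simp only [div_eq_mul_inv]
      rw [ENNReal.tsum_mul_right, h1, ENNReal.mul_inv_cancel h0 htop]
    exact h2 ▸ ENNReal.summable.hasSum⟩

/-- The random family `ν`, indexed by finite words, gives the numbers of children in a
Galton-Watson tree with degree distribution `F_*`: they are independent, the root (the empty word)
has offspring law `F_*`, and all other words have offspring law `F`. -/
structure IsDegreeGW {Ω : Type*} [MeasurableSpace Ω] (P : Measure Ω) (Fs : PMF ℕ)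
    (h0 : mean Fs ≠ 0) (htop : mean Fs ≠ ∞) (ν : List ℕ → Ω → ℕ) : Prop where
  indep : iIndepFun ν P
  law_root : HasLaw (ν []) Fs.toMeasure P
  law_node : ∀ u : List ℕ, u ≠ [] → HasLaw (ν u) (offspringLaw Fs h0 htop).toMeasure P

/-- The vertices of generation at most `n` of the tree with offspring numbers `ν`, as words: the
root is `[]`, and the children of a vertex `u` are `u ++ [i]` for `i < ν u`. -/
def nodes (ν : List ℕ → ℕ) (n : ℕ) : Set (List ℕ) :=
  {v | v.length ≤ n ∧ ∀ (u : List ℕ) (i : ℕ), u ++ [i] <+: v → i < ν u}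

theorem nil_mem_nodes (ν : List ℕ → ℕ) (n : ℕ) : [] ∈ nodes ν n :=
  ⟨Nat.zero_le n, fun u i h => by simp at h⟩

theorem finite_nodes (ν : List ℕ → ℕ) (n : ℕ) : (nodes ν n).Finite := by
  induction n generalizing ν with
  | zero =>
    refine (Set.finite_singleton ([] : List ℕ)).subset fun v hv => ?_
    simpa using hv.1
  | succ n ih =>
    refine ((Set.finite_singleton ([] : List ℕ)).union
      ((Set.finite_Iio (ν [])).biUnion fun i _ =>
        (ih (fun u => ν (i :: u))).image (List.cons i))).subset fun v hv => ?_
    cases v with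
    | nil => simp
    | cons i w =>
      refine Or.inr (Set.mem_biUnion (x := i) (hv.2 [] i (by simp)) ⟨w, ⟨?_, ?_⟩, rfl⟩)
      · simpa using hv.1
      · intro u j h
        exact hv.2 (i :: u) j (by simpa using h)

noncomputable instance (ν : List ℕ → ℕ) (n : ℕ) : Fintype (nodes ν n) :=
  (finite_nodes ν n).fintype

/-- The tree `T_n`: the tree with offspring numbers `ν`, stopped at generation `n`. Edges join each
vertex to its children. -/
def tree (ν : List ℕ → ℕ) (n : ℕ) : SimpleGraph (nodes ν n) where
  Adj u v := (∃ i, v.1 = u.1 ++ [i]) ∨ (∃ i, u.1 = v.1 ++ [i])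
  symm := ⟨fun _ _ h => h.symm⟩
  loopless := ⟨fun u h => by rcases h with ⟨i, h⟩ | ⟨i, h⟩ <;> simp at h⟩

/-! ### The resolvent at the root -/

open scoped Classical in
/-- The matrix `Δ(T_n) = A(T_n) - α D(T_n)`, with `A` the adjacency matrix and `D` the diagonal
matrix of the degrees in `T_n`. -/
noncomputable def treeMatrix (α : ℝ) (ν : List ℕ → ℕ) (n : ℕ) :
    Matrix (nodes ν n) (nodes ν n) ℂ :=
  (tree ν n).adjMatrix ℂ - (α : ℂ) • (tree ν n).degMatrix ℂ

open scoped Classical in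
/-- The diagonal entry at the root of the resolvent `(Δ(T_n) - z I)⁻¹`. -/
noncomputable def rootResolvent (α : ℝ) (z : ℍ) (ν : List ℕ → ℕ) (n : ℕ) : ℂ :=
  (treeMatrix α ν n - (z : ℂ) • (1 : Matrix (nodes ν n) (nodes ν n) ℂ))⁻¹
    ⟨[], nil_mem_nodes ν n⟩ ⟨[], nil_mem_nodes ν n⟩

end GWResolvent

namespace GWResolvent

/-! ### Families of bounded holomorphic functions -/

/-! The recursion is run on an actual tree: `iter` starts from arbitrary boundary values at
generation `n` and computes the value at the root. Everything rests on `ae_forgetsAt`: for almost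
every Galton-Watson tree with offspring law `F`, the root value at each `z` forgets the boundary
values, uniformly in them, as `n → ∞`. The root values then converge to `gwLimit`, whose law solves
the equation (`isRDESolution_limitLaw`). Conversely, if `Q` is a solution and the boundary values
are i.i.d. with law `Q`, the root value has law `Q` for every `n` but converges to `gwLimit`; so `Q`
is the law of `gwLimit` (`IsRDESolution.eq_limitLaw`). Solving the resolvent equation along paths
from the root expresses the resolvent of the truncated tree by the same recursion, with the law
`F_*` at the root only (`rootResolvent_succ`); this gives (b).

By Vitali's theorem (`HolSpace.tendsto_sub_of_accumulation`), forgetting need only be checked on a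
sequence of points accumulating inside `ℍ`. For `α = 1`, where `Re z` and `Im z` are large enough,
each step contracts by `1/4` whatever the degrees (`norm_inv_sub_inv_le`).

For `α = 0` unbounded degrees rule out this argument. At `z = it` the root value lies in a disc
centred on the imaginary axis whose diameter joins two consecutive iterates started from `0`
(`inDisc_iter`). The even iterates increase to a limit `l` and the odd ones decrease to `u ≥ l`,
with `u = 1/(t + ∑ l_i)` and `l = 1/(t + ∑ u_i)`. Since `F` is the size-biased law of `F_*`, `E_*[∑
y_i / (t + ∑ y_i)] = m E[xy' / (1 + xy')]` whenever `x = 1/(t + ∑ y_i)`, with `y'` an independent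
copy of `y`. The right side is the same for `(x, y) = (u, l)` and `(l, u)`. As `s ↦ s/(t+s)` is
strictly increasing and `l ≤ u`, this forces `l = u` almost surely (`ae_imLower_eq_imUpper`), and
the discs shrink to points. -/

theorem dist_le_of_norm_le_on_ball {f : ℂ → ℂ} {c : ℂ} {R M : ℝ}
    (hf : DifferentiableOn ℂ f (Metric.ball c R)) (hM : ∀ w ∈ Metric.ball c R, ‖f w‖ ≤ M)
    {w : ℂ} (hw : w ∈ Metric.ball c R) : dist (f w) (f c) ≤ 2 * M / R * dist w c := by
  have hR : 0 < R := Metric.nonempty_ball.1 ⟨w, hw⟩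
  refine Complex.dist_le_div_mul_dist_of_mapsTo_ball hf (fun x hx => ?_) hw
  rw [Metric.mem_closedBall, dist_eq_norm]
  linarith [norm_sub_le (f x) (f c), hM x hx, hM c (Metric.mem_ball_self hR)]

theorem tendsto_zero_center {ι : Type*} {l : Filter ι} {d : ι → ℂ → ℂ} {c : ℂ} {R M : ℝ}
    (hR : 0 < R) (hd : ∀ i, DifferentiableOn ℂ (d i) (Metric.ball c R))
    (hM : ∀ i, ∀ w ∈ Metric.ball c R, ‖d i w‖ ≤ M)
    {w : ℕ → ℂ} (hw : Tendsto w atTop (𝓝 c))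
    (h : ∀ k, Tendsto (fun i => d i (w k)) l (𝓝 0)) : Tendsto (fun i => d i c) l (𝓝 0) := by
  rcases isEmpty_or_nonempty ι with hι | ⟨⟨i₀⟩⟩
  · exact tendsto_of_isEmpty
  have hM0 : 0 ≤ M := (norm_nonneg _).trans (hM i₀ c (Metric.mem_ball_self hR))
  rw [Metric.tendsto_nhds]
  intro ε hε
  have h1 : Tendsto (fun k => 2 * M / R * dist (w k) c) atTop (𝓝 (2 * M / R * dist c c)) :=
    ((hw.dist tendsto_const_nhds).const_mul _)
  rw [dist_self, mul_zero] at h1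
  obtain ⟨k, hk, hkR⟩ := ((h1.eventually (gt_mem_nhds (half_pos hε))).and
    (hw.eventually (Metric.ball_mem_nhds c hR))).exists
  filter_upwards [(Metric.tendsto_nhds.1 (h k)) _ (half_pos hε)] with i hi
  have h2 := dist_le_of_norm_le_on_ball (hd i) (hM i) hkR
  rw [dist_comm] at h2
  linarith [dist_triangle (d i c) (d i (w k)) 0]

/-- Dividing out the zero that appears in the limit at `c` gives `d x = d c + (x - c) * dslope d c
x`. The slopes are again holomorphic, tend to `0` along `w`, and are bounded by `2M/R` by Schwarz's
lemma, so each division gains a factor `2|x - c|/R`. The family `d` and the bound `M` change at each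
stage, hence the quantifiers inside the induction. -/
theorem eventually_norm_le_of_tendsto_zero {ι : Type*} {l : Filter ι} {c : ℂ} {R : ℝ} (hR : 0 < R)
    {w : ℕ → ℂ} (hw : Tendsto w atTop (𝓝 c)) (hwc : ∀ k, w k ≠ c) {x : ℂ}
    (hx : x ∈ Metric.ball c R) (n : ℕ) :
    ∀ (d : ι → ℂ → ℂ) (M : ℝ), (∀ i, DifferentiableOn ℂ (d i) (Metric.ball c R)) →
      (∀ i, ∀ y ∈ Metric.ball c R, ‖d i y‖ ≤ M) →
      (∀ k, Tendsto (fun i => d i (w k)) l (𝓝 0)) →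
      ∀ ε > 0, ∀ᶠ i in l, ‖d i x‖ ≤ ε + M * (2 * dist x c / R) ^ n := by
  induction n with
  | zero =>
    intro d M _ hM _ ε hε
    filter_upwards with i
    rw [pow_zero, mul_one]
    linarith [hM i x hx]
  | succ n ih =>
    intro d M hd hM h ε hε
    have hc := tendsto_zero_center hR hd hM hw h
    have hball : Metric.ball c R ∈ 𝓝 c := Metric.ball_mem_nhds c hR
    have hmaps : ∀ i, Set.MapsTo (d i) (Metric.ball c R) (Metric.closedBall (d i c) (2 * M)) := by
      intro i y hy
      rw [Metric.mem_closedBall, dist_eq_norm]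
      linarith [norm_sub_le (d i y) (d i c), hM i y hy, hM i c (Metric.mem_ball_self hR)]
    have hb := ih (fun i => dslope (d i) c) (2 * M / R)
      (fun i => (Complex.differentiableOn_dslope hball).2 (hd i))
      (fun i y hy => Complex.norm_dslope_le_div_of_mapsTo_ball (hd i) (hmaps i) hy)
      (fun k => by
        have h1 : Tendsto (fun i => (w k - c)⁻¹ • (d i (w k) - d i c)) l
            (𝓝 ((w k - c)⁻¹ • (0 - 0))) := ((h k).sub hc).const_smul _
        rw [sub_zero, smul_zero] at h1
        refine h1.congr fun i => ?_
        rw [dslope_of_ne _ (hwc k), slope_def_module])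
      (ε / (2 * R)) (by positivity)
    filter_upwards [hb, (Metric.tendsto_nhds.1 hc) _ (half_pos hε)] with i h1 h2
    have h3 : d i x = d i c + (x - c) * dslope (d i) c x := by
      rw [← smul_eq_mul, sub_smul_dslope]
      ring
    have h4 : dist x c < R := hx
    have h5 : ‖d i x‖ ≤ ‖d i c‖ + dist x c * ‖dslope (d i) c x‖ := by
      rw [h3, dist_eq_norm, ← norm_mul]
      exact norm_add_le _ _
    rw [dist_zero_right] at h2
    have h6 := mul_le_mul_of_nonneg_left h1 (dist_nonneg (x := x) (y := c))
    have h7 : dist x c * (ε / (2 * R)) ≤ ε / 2 := by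
      rw [mul_div_assoc', div_le_div_iff₀ (by positivity) (by positivity)]
      nlinarith
    have h8 : dist x c * (2 * M / R * (2 * dist x c / R) ^ n)
        = M * (2 * dist x c / R) ^ (n + 1) := by
      rw [pow_succ]; ring
    rw [mul_add, h8] at h6
    linarith

theorem tendsto_zero_of_accumulation {ι : Type*} {l : Filter ι} {d : ι → ℂ → ℂ} {c : ℂ} {R M : ℝ}
    (hR : 0 < R) (hd : ∀ i, DifferentiableOn ℂ (d i) (Metric.ball c R))
    (hM : ∀ i, ∀ w ∈ Metric.ball c R, ‖d i w‖ ≤ M)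
    {w : ℕ → ℂ} (hw : Tendsto w atTop (𝓝 c)) (hwc : ∀ k, w k ≠ c)
    (h : ∀ k, Tendsto (fun i => d i (w k)) l (𝓝 0)) {x : ℂ} (hx : x ∈ Metric.ball c (R / 2)) :
    Tendsto (fun i => d i x) l (𝓝 0) := by
  have hlt : dist x c < R / 2 := hx
  have hxR : x ∈ Metric.ball c R := Metric.ball_subset_ball (by linarith) hx
  have hq : 2 * dist x c / R < 1 := by rw [div_lt_one hR]; linarith
  have hpow : Tendsto (fun n => M * (2 * dist x c / R) ^ n) atTop (𝓝 (M * 0)) :=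
    (tendsto_pow_atTop_nhds_zero_of_lt_one (by positivity) hq).const_mul M
  rw [mul_zero] at hpow
  rw [Metric.tendsto_nhds]
  intro ε hε
  obtain ⟨n, hn⟩ := (hpow.eventually (gt_mem_nhds (half_pos hε))).exists
  filter_upwards [eventually_norm_le_of_tendsto_zero hR hw (fun k => hwc _) hxR n d M hd hM (fun k => h _) (ε / 3) (by positivity)] with i hi
  rw [dist_zero_right]
  linarith

theorem half_im_lt_of_mem_ball {c : ℂ} {w : ℂ} (hw : w ∈ Metric.ball c (c.im / 2)) :
    c.im / 2 < w.im := by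
  have h1 : |(w - c).im| ≤ ‖w - c‖ := Complex.abs_im_le_norm _
  rw [Metric.mem_ball, dist_eq_norm] at hw
  rw [Complex.sub_im, abs_le] at h1
  linarith [h1.1]

/-- **Vitali's theorem** for differences of functions of `HolSpace`. -/
theorem HolSpace.tendsto_sub_of_accumulation {ι : Type*} {l : Filter ι} {f g : ι → HolSpace}
    {c : ℍ} {w : ℕ → ℍ} (hw : Tendsto w atTop (𝓝 c)) (hwc : ∀ k, w k ≠ c)
    (h : ∀ k, Tendsto (fun i => f i (w k) - g i (w k)) l (𝓝 0)) (z : ℍ) :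
    Tendsto (fun i => f i z - g i z) l (𝓝 0) := by
  set d : ι → ℂ → ℂ := fun i x => f i (ofComplex x) - g i (ofComplex x) with hd_def
  have hd : ∀ i, DifferentiableOn ℂ (d i) {x | 0 < x.im} := fun i =>
    (UpperHalfPlane.mdifferentiable_iff.1 (f i).holomorphic).sub
      (UpperHalfPlane.mdifferentiable_iff.1 (g i).holomorphic)
  have hb : ∀ i (x : ℂ), 0 < x.im → ‖d i x‖ ≤ 2 / x.im := by
    intro i x hx
    have h1 := (f i).norm_le (ofComplex x)
    have h2 := (g i).norm_le (ofComplex x)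
    have h3 : (ofComplex x).im = x.im := by rw [ofComplex_apply_of_im_pos hx]; rfl
    rw [h3] at h1 h2
    refine (norm_sub_le _ _).trans ?_
    calc _ ≤ 1 / x.im + 1 / x.im := add_le_add h1 h2
      _ = 2 / x.im := by ring
  have hsub : ∀ {c : ℂ}, 0 < c.im → Metric.ball c (c.im / 2) ⊆ {x : ℂ | 0 < x.im} := by
    intro c hc x hx
    have := half_im_lt_of_mem_ball hx
    simp only [Set.mem_ofPred_eq]
    linarith
  have key : ∀ (c : ℂ), 0 < c.im → ∀ w : ℕ → ℂ, Tendsto w atTop (𝓝 c) → (∀ k, w k ≠ c) →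
      (∀ k, Tendsto (fun i => d i (w k)) l (𝓝 0)) →
      ∀ x ∈ Metric.ball c (c.im / 4), Tendsto (fun i => d i x) l (𝓝 0) := by
    intro c hc w hw hwc h x hx
    refine tendsto_zero_of_accumulation (R := c.im / 2) (M := 4 / c.im) (by positivity)
      (fun i => (hd i).mono (hsub hc)) (fun i y hy => ?_) hw hwc h (by
        convert hx using 1; ring_nf)
    have h1 := half_im_lt_of_mem_ball hy
    refine (hb i y (hsub hc hy)).trans ?_
    rw [div_le_div_iff₀ (hsub hc hy) hc]
    linarith
  -- A connectedness argument: the interior of the convergence set meets the half-plane and is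
  -- relatively closed in it.
  set U : Set ℂ := interior {x : ℂ | Tendsto (fun i => d i x) l (𝓝 0)} with hU
  have hUball : ∀ c : ℂ, 0 < c.im → (∀ x ∈ Metric.ball c (c.im / 4),
      Tendsto (fun i => d i x) l (𝓝 0)) → Metric.ball c (c.im / 4) ⊆ U := fun c _ h =>
    interior_maximal h Metric.isOpen_ball
  have hconn : IsPreconnected {x : ℂ | 0 < x.im} :=
    (convex_halfSpace_im_gt 0).isPreconnected
  have hsubset : {x : ℂ | 0 < x.im} ⊆ U := by
    refine hconn.subset_of_closure_inter_subset isOpen_interior ⟨(c : ℂ), c.im_pos, ?_⟩ ?_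
    · refine hUball c c.im_pos (key c c.im_pos (fun k => (w k : ℂ))
        ((UpperHalfPlane.continuous_coe.tendsto c).comp hw) (fun k hk => hwc k ?_) ?_)
        (Metric.mem_ball_self (by have := c.im_pos; positivity))
      · exact UpperHalfPlane.ext hk
      · intro k
        simpa [hd_def] using h k
    · rintro x ⟨hx, hx0⟩
      simp only [Set.mem_ofPred_eq] at hx0
      -- The radius `x.im / 8` makes `y.im > x.im / 2`, so that the ball of radius `y.im / 4` about
      -- `y` reaches back to `x`.
      obtain ⟨y, hyU, hxy⟩ := Metric.mem_closure_iff.1 hx (x.im / 8) (by positivity)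
      have hyim : x.im / 2 < y.im := half_im_lt_of_mem_ball (by
        rw [Metric.mem_ball, dist_comm]; linarith)
      have hy0 : 0 < y.im := by linarith
      have hxball : x ∈ Metric.ball y (y.im / 4) := by
        rw [Metric.mem_ball]; linarith
      refine hUball y hy0 ?_ hxball
      have hUy : {x : ℂ | Tendsto (fun i => d i x) l (𝓝 0)} ∈ 𝓝 y :=
        mem_interior_iff_mem_nhds.1 hyU
      have hseq : Tendsto (fun k : ℕ => y + (1 / ((k : ℂ) + 1))) atTop (𝓝 (y + 0)) :=
        tendsto_const_nhds.add tendsto_one_div_add_atTop_nhds_zero_nat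
      rw [add_zero] at hseq
      obtain ⟨k₀, hk₀⟩ := eventually_atTop.1 (hseq.eventually hUy)
      refine key y hy0 (fun k => y + (1 / (((k + k₀ : ℕ) : ℂ) + 1)))
        ((tendsto_add_atTop_iff_nat k₀).2 hseq) (fun k hk => ?_) (fun k => hk₀ _ (by omega))
      have h1 : (1 / (((k + k₀ : ℕ) : ℂ) + 1)) = 0 := by simpa using hk
      have h2 : (((k + k₀ : ℕ) : ℂ) + 1) ≠ 0 := Nat.cast_add_one_ne_zero _
      exact one_div_ne_zero h2 h1
  have h1 : Tendsto (fun i => d i (z : ℂ)) l (𝓝 0) := interior_subset (hsubset z.im_pos)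
  simpa [hd_def] using h1

/-- A pointwise limit of elements of `HolSpace` with positive imaginary part is in `HolSpace`. -/
theorem HolSpace.exists_limit {f : ℕ → HolSpace} {F : ℍ → ℂ}
    (hF : ∀ z, Tendsto (fun n => f n z) atTop (𝓝 (F z))) (hpos : ∀ z, 0 < (F z).im) :
    ∃ g : HolSpace, ∀ z, g z = F z := by
  refine ⟨⟨F, ?_, hpos, fun z => le_of_tendsto (hF z).norm
    (Eventually.of_forall fun n => (f n).norm_le z)⟩, fun z => rfl⟩
  rw [UpperHalfPlane.mdifferentiable_iff]
  intro c hc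
  simp only [Set.mem_ofPred_eq] at hc
  set G : ℕ → ℂ → ℂ := fun n x => f n (ofComplex x) with hG
  have hdG : ∀ n, DifferentiableOn ℂ (G n) {x | 0 < x.im} := fun n =>
    UpperHalfPlane.mdifferentiable_iff.1 (f n).holomorphic
  have hbG : ∀ n (x : ℂ), 0 < x.im → ‖G n x‖ ≤ 1 / x.im := by
    intro n x hx
    have h1 := (f n).norm_le (ofComplex x)
    rwa [show (ofComplex x).im = x.im by rw [ofComplex_apply_of_im_pos hx]; rfl] at h1
  have hlip : ∀ n, LipschitzOnWith (Real.toNNReal (16 / (c.im * c.im))) (G n)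
      (Metric.closedBall c (c.im / 16)) := by
    intro n
    refine LipschitzOnWith.of_dist_le_mul fun x hx y hy => ?_
    rw [Metric.mem_closedBall] at hx hy
    have him : ∀ w ∈ Metric.ball y (c.im / 4), c.im / 2 < w.im := by
      intro w hw
      refine half_im_lt_of_mem_ball ?_
      rw [Metric.mem_ball] at hw ⊢
      linarith [dist_triangle w y c]
    have h1 := dist_le_of_norm_le_on_ball (f := G n) (c := y) (R := c.im / 4) (M := 2 / c.im)
      ((hdG n).mono fun w hw => by have := him w hw; simp only [Set.mem_ofPred_eq]; linarith)
      (fun w hw => by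
        have h2 := him w hw
        refine (hbG n w (by linarith)).trans ?_
        rw [div_le_div_iff₀ (by linarith) hc]
        linarith)
      (w := x) (by rw [Metric.mem_ball]; linarith [dist_triangle x c y, dist_comm y c])
    rw [Real.coe_toNNReal _ (by positivity)]
    refine h1.trans (le_of_eq ?_)
    field_simp
    ring
  have hunif : TendstoUniformlyOn G (F ∘ ofComplex) atTop (Metric.closedBall c (c.im / 16)) := by
    have h1 := (EquicontinuousOn.tendsto_uniformOnFun_iff_pi'
      (𝔖 := {Metric.closedBall c (c.im / 16)})
      (by rintro K rfl; exact isCompact_closedBall _ _)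
      (F := G) (by
        rintro K rfl
        exact (LipschitzOnWith.uniformEquicontinuousOn G _ hlip).equicontinuousOn)
      atTop (F ∘ ofComplex)).2 (by
        rw [tendsto_pi_nhds]
        rintro ⟨x, hx⟩
        exact hF _)
    exact (UniformOnFun.tendsto_iff_tendstoUniformlyOn.1 h1) _ rfl
  have hloc : TendstoLocallyUniformlyOn G (F ∘ ofComplex) atTop (Metric.ball c (c.im / 16)) :=
    (hunif.mono Metric.ball_subset_closedBall).tendstoLocallyUniformlyOn
  have hsub : Metric.ball c (c.im / 16) ⊆ {x : ℂ | 0 < x.im} := by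
    intro x hx
    have := half_im_lt_of_mem_ball (Metric.ball_subset_ball (by linarith) hx)
    simp only [Set.mem_ofPred_eq]
    linarith
  have hdiff := hloc.differentiableOn (Eventually.of_forall fun n => (hdG n).mono hsub)
    Metric.isOpen_ball
  exact (hdiff.differentiableAt (Metric.ball_mem_nhds c (by positivity))).differentiableWithinAt

/-! ### Iterating the recursion along a tree -/

/-- The family of labels of the subtree rooted at the `i`-th child of the root. -/
def shift {E : Type*} (i : ℕ) (m : List ℕ → E) : List ℕ → E := fun u => m (i :: u)

/-- The value at the root of the recursion started `n` generations above it with the boundary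
values `bd`, along the tree with offspring numbers `ν`. -/
noncomputable def iter (α : ℝ) : ℕ → (List ℕ → ℕ) → (List ℕ → HolSpace) → HolSpace
  | 0, _, bd => bd []
  | n + 1, ν, bd => step (α * (ν [] + 1)) (ν []) fun i => iter α n (shift i ν) (shift i bd)

theorem step_apply (a : ℝ) (n : ℕ) (h : ℕ → HolSpace) (z : ℍ) :
    step a n h z = -((z : ℂ) + a + ∑ i ∈ Finset.range n, h i z)⁻¹ := rfl

theorem denominator_ne_zero (a : ℝ) (n : ℕ) (h : ℕ → HolSpace) (z : ℍ) :
    (z : ℂ) + a + ∑ i ∈ Finset.range n, h i z ≠ 0 := by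
  intro h0
  have h1 := im_le_im_denominator a n h z
  rw [h0] at h1
  exact absurd h1 (not_le.2 (by simpa using z.im_pos))

/-- Cutting at generation `n` turns a deeper iterate into a depth-`n` iterate with other boundary
values. Uniform forgetting therefore makes the root values a Cauchy sequence. -/
theorem iter_add (α : ℝ) (n k : ℕ) (ν : List ℕ → ℕ) (bd : List ℕ → HolSpace) :
    iter α (n + k) ν bd
      = iter α n ν fun u => iter α k (fun v => ν (u ++ v)) fun v => bd (u ++ v) := by
  induction n generalizing ν bd with
  | zero => simp [iter]
  | succ n ih =>
    rw [Nat.add_right_comm, iter, iter]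
    congr 1
    funext i
    rw [ih]
    rfl

/-- A sequence of points of `ℍ` at which the recursion will be shown to contract. -/
noncomputable def testPoint (α : ℝ) (k : ℕ) : ℍ :=
  ⟨α + ((2 + 1 / (k + 1) : ℝ) : ℂ) * Complex.I, by
    rw [Complex.add_im, Complex.ofReal_im, Complex.im_ofReal_mul, Complex.I_im]
    positivity⟩

/-- The limit of the sequence `testPoint α`. -/
noncomputable def testLimit (α : ℝ) : ℍ := ⟨α + ((2 : ℝ) : ℂ) * Complex.I, by simp⟩

theorem tendsto_testPoint (α : ℝ) : Tendsto (testPoint α) atTop (𝓝 (testLimit α)) := by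
  rw [UpperHalfPlane.isEmbedding_coe.tendsto_nhds_iff]
  have h1 : Tendsto (fun k : ℕ => (2 + 1 / ((k : ℝ) + 1))) atTop (𝓝 (2 + 0)) :=
    tendsto_const_nhds.add tendsto_one_div_add_atTop_nhds_zero_nat
  rw [add_zero] at h1
  exact tendsto_const_nhds.add
    (((Complex.continuous_ofReal.tendsto _).comp h1).mul tendsto_const_nhds)

theorem testPoint_im (α : ℝ) (k : ℕ) : (testPoint α k).im = 2 + 1 / (k + 1) := by
  change (α + ((2 + 1 / (k + 1) : ℝ) : ℂ) * Complex.I).im = _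
  rw [Complex.add_im, Complex.ofReal_im, Complex.im_ofReal_mul, Complex.I_im]
  ring

theorem testPoint_ne (α : ℝ) (k : ℕ) : testPoint α k ≠ testLimit α := by
  intro h
  have h1 := congrArg UpperHalfPlane.im h
  rw [testPoint_im] at h1
  have h2 : (testLimit α).im = 2 := by
    change (α + ((2 : ℝ) : ℂ) * Complex.I).im = _
    rw [Complex.add_im, Complex.ofReal_im, Complex.im_ofReal_mul, Complex.I_im]
    ring
  have h3 : (0 : ℝ) < 1 / (k + 1) := by positivity
  linarith

/-- The root value of the recursion along `ν` forgets the boundary values at the point `z`. -/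
def ForgetsAt (α : ℝ) (ν : List ℕ → ℕ) (z : ℍ) : Prop :=
  Tendsto (fun p : ℕ × (List ℕ → HolSpace) × (List ℕ → HolSpace) =>
    iter α p.1 ν p.2.1 z - iter α p.1 ν p.2.2 z) (atTop ×ˢ ⊤) (𝓝 0)

/-- The factor `⊤` of the filter encodes uniformity in both boundary families; Vitali's theorem
holds along any filter, so uniformity passes from the test points to every `z`. -/
theorem ForgetsAt.of_testPoint {α : ℝ} {ν : List ℕ → ℕ}
    (h : ∀ k, ForgetsAt α ν (testPoint α k)) (z : ℍ) : ForgetsAt α ν z :=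
  HolSpace.tendsto_sub_of_accumulation
    (f := fun p : ℕ × (List ℕ → HolSpace) × (List ℕ → HolSpace) => iter α p.1 ν p.2.1)
    (g := fun p => iter α p.1 ν p.2.2) (tendsto_testPoint α) (testPoint_ne α) h z

theorem ForgetsAt.of_norm_le {α : ℝ} {ν : List ℕ → ℕ} {z : ℍ} {δ : ℕ → ℝ}
    (hδ : Tendsto δ atTop (𝓝 0))
    (h : ∀ n bd bd', ‖iter α n ν bd z - iter α n ν bd' z‖ ≤ δ n) : ForgetsAt α ν z :=
  squeeze_zero_norm (fun p => h p.1 p.2.1 p.2.2) (hδ.comp tendsto_fst)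

/-! ### Contraction for the Laplacian -/

/-- The term `N + 1` outweighs the `N` summands of norm at most `1/2`: both denominators have norm
at least `2 + N/2`, while their difference has norm at most `Nδ`. -/
theorem norm_inv_sub_inv_le {w : ℂ} (hw : 1 ≤ w.re) {δ : ℝ} {N : ℕ} {a b : ℕ → ℂ}
    (ha : ∀ i, ‖a i‖ ≤ 1 / 2) (hb : ∀ i, ‖b i‖ ≤ 1 / 2) (hab : ∀ i, ‖a i - b i‖ ≤ δ) :
    ‖-(w + (N + 1 : ℝ) + ∑ i ∈ Finset.range N, a i)⁻¹
      - -(w + (N + 1 : ℝ) + ∑ i ∈ Finset.range N, b i)⁻¹‖ ≤ 1 / 4 * δ := by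
  have hδ : 0 ≤ δ := (norm_nonneg _).trans (hab 0)
  have hden : ∀ c : ℕ → ℂ, (∀ i, ‖c i‖ ≤ 1 / 2) →
      2 + (N : ℝ) / 2 ≤ ‖w + (N + 1 : ℝ) + ∑ i ∈ Finset.range N, c i‖ := by
    intro c hc
    have h1 : ‖∑ i ∈ Finset.range N, c i‖ ≤ N * (1 / 2) := by
      simpa using norm_sum_le_of_le (Finset.range N) fun i _ => hc i
    have h2 := Complex.abs_re_le_norm (∑ i ∈ Finset.range N, c i)
    have h3 := Complex.re_le_norm (w + (N + 1 : ℝ) + ∑ i ∈ Finset.range N, c i)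
    rw [Complex.add_re, Complex.add_re, Complex.ofReal_re] at h3
    linarith [neg_abs_le (∑ i ∈ Finset.range N, c i).re]
  set A := w + (N + 1 : ℝ) + ∑ i ∈ Finset.range N, a i with hA
  set B := w + (N + 1 : ℝ) + ∑ i ∈ Finset.range N, b i with hB
  have hA1 := hden a ha
  have hB1 := hden b hb
  rw [← hA] at hA1
  rw [← hB] at hB1
  have hA0 : A ≠ 0 := norm_pos_iff.1 (lt_of_lt_of_le (by positivity) hA1)
  have hB0 : B ≠ 0 := norm_pos_iff.1 (lt_of_lt_of_le (by positivity) hB1)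
  have h1 : -A⁻¹ - -B⁻¹ = (A - B) * A⁻¹ * B⁻¹ := by field_simp; ring
  have h2 : ‖A - B‖ ≤ N * δ := by
    have h3 : A - B = ∑ i ∈ Finset.range N, (a i - b i) := by
      rw [Finset.sum_sub_distrib, hA, hB]; ring
    rw [h3]
    simpa using norm_sum_le_of_le (Finset.range N) fun i _ => hab i
  rw [h1, norm_mul, norm_mul, norm_inv, norm_inv, ← div_eq_mul_inv, ← div_eq_mul_inv, div_div,
    div_le_iff₀ (by positivity)]
  have h4 : (2 + (N : ℝ) / 2) * (2 + (N : ℝ) / 2) ≤ ‖A‖ * ‖B‖ :=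
    mul_le_mul hA1 hB1 (by positivity) (norm_nonneg _)
  -- AM-GM: `(2 + N/2)^2 ≥ 4N`.
  have h5 : (N : ℝ) ≤ 1 / 4 * (‖A‖ * ‖B‖) := by nlinarith [sq_nonneg ((N : ℝ) / 2 - 2)]
  nlinarith

theorem norm_iter_sub_iter_le {z : ℍ} (hre : 1 ≤ z.re) (him : 2 ≤ z.im) (n : ℕ)
    (ν : List ℕ → ℕ) (bd bd' : List ℕ → HolSpace) :
    ‖iter 1 n ν bd z - iter 1 n ν bd' z‖ ≤ (1 / 4) ^ n := by
  have hhalf : ∀ f : HolSpace, ‖f z‖ ≤ 1 / 2 := fun f =>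
    (f.norm_le z).trans (one_div_le_one_div_of_le two_pos him)
  induction n generalizing ν bd bd' with
  | zero =>
    rw [pow_zero]
    linarith [norm_sub_le (iter 1 0 ν bd z) (iter 1 0 ν bd' z), hhalf (iter 1 0 ν bd),
      hhalf (iter 1 0 ν bd')]
  | succ n ih =>
    rw [iter, iter, step_apply, step_apply, one_mul, pow_succ']
    exact norm_inv_sub_inv_le hre (fun _ => hhalf _) (fun _ => hhalf _) fun i => ih _ _ _

theorem forgetsAt_one (ν : List ℕ → ℕ) (z : ℍ) : ForgetsAt 1 ν z := by
  refine ForgetsAt.of_testPoint (fun k => ?_) z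
  refine ForgetsAt.of_norm_le (tendsto_pow_atTop_nhds_zero_of_lt_one (by norm_num)
    (by norm_num : (1 / 4 : ℝ) < 1)) fun n bd bd' => norm_iter_sub_iter_le ?_ ?_ n ν bd bd'
  · change 1 ≤ (((1 : ℝ) : ℂ) + ((2 + 1 / (k + 1) : ℝ) : ℂ) * Complex.I).re
    rw [Complex.add_re, Complex.ofReal_re, Complex.re_ofReal_mul, Complex.I_re]
    simp
  · rw [testPoint_im]
    have : (0 : ℝ) < 1 / (k + 1) := by positivity
    linarith

/-! ### Nested discs for the adjacency matrix -/

/-- The iterates of the recursion on the imaginary half-line, started from `0`. -/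
noncomputable def imIter (t : ℝ) : ℕ → (List ℕ → ℕ) → ℝ
  | 0, _ => 0
  | n + 1, ν => (t + ∑ i ∈ Finset.range (ν []), imIter t n (shift i ν))⁻¹

theorem imIter_nonneg {t : ℝ} (ht : 0 < t) (n : ℕ) (ν : List ℕ → ℕ) : 0 ≤ imIter t n ν := by
  induction n generalizing ν with
  | zero => exact le_rfl
  | succ n ih => exact inv_nonneg.2 (add_nonneg ht.le (Finset.sum_nonneg fun i _ => ih _))

theorem imIter_denominator_pos {t : ℝ} (ht : 0 < t) (n N : ℕ) (ν : ℕ → List ℕ → ℕ) :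
    0 < t + ∑ i ∈ Finset.range N, imIter t n (ν i) :=
  add_pos_of_pos_of_nonneg ht (Finset.sum_nonneg fun _ _ => imIter_nonneg ht _ _)

theorem imIter_le {t : ℝ} (ht : 0 < t) (n : ℕ) (ν : List ℕ → ℕ) : imIter t n ν ≤ t⁻¹ := by
  cases n with
  | zero => exact inv_nonneg.2 ht.le
  | succ n =>
    exact inv_anti₀ ht (le_add_of_nonneg_right (Finset.sum_nonneg fun i _ => imIter_nonneg ht _ _))

theorem imIter_succ_le_succ {t : ℝ} (ht : 0 < t) {k n : ℕ}
    (h : ∀ ν, imIter t k ν ≤ imIter t n ν) (ν : List ℕ → ℕ) :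
    imIter t (n + 1) ν ≤ imIter t (k + 1) ν :=
  inv_anti₀ (imIter_denominator_pos ht _ _ _)
    (add_le_add_right (Finset.sum_le_sum fun i _ => h (shift i ν)) t)

/-- One step of the recursion reverses inequalities and two steps preserve them; the induction
starts from `imIter t 0 = 0`. -/
theorem imIter_even_le {t : ℝ} (ht : 0 < t) (k j : ℕ) (ν : List ℕ → ℕ) :
    imIter t (2 * k) ν ≤ imIter t (2 * k + j) ν := by
  induction k generalizing ν with
  | zero => exact imIter_nonneg ht _ _
  | succ k ih =>
    have := imIter_succ_le_succ ht (imIter_succ_le_succ ht ih) ν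
    convert this using 2 <;> omega

theorem imIter_le_odd {t : ℝ} (ht : 0 < t) (k j : ℕ) (ν : List ℕ → ℕ) :
    imIter t (2 * k + 1 + j) ν ≤ imIter t (2 * k + 1) ν := by
  have := imIter_succ_le_succ ht (imIter_even_le ht k j) ν
  convert this using 2
  omega

/-- The closed disc which has the segment between `a i` and `b i` as a diameter. -/
def InDisc (a b : ℝ) (w : ℂ) : Prop := ‖w - ((a + b) / 2 : ℝ) * Complex.I‖ ≤ |b - a| / 2

/-- In this form `w ↦ -w⁻¹` only rescales the inequality, by `p q |w|^2`, which is all that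
`InDisc.neg_inv` needs. -/
theorem inDisc_iff {a b : ℝ} {w : ℂ} :
    InDisc a b w ↔ Complex.normSq w - (a + b) * w.im + a * b ≤ 0 := by
  rw [InDisc, ← sq_le_sq₀ (norm_nonneg _) (by positivity), ← Complex.normSq_eq_norm_sq, div_pow,
    sq_abs, Complex.normSq_apply, Complex.normSq_apply, Complex.sub_re, Complex.sub_im,
    Complex.re_ofReal_mul, Complex.im_ofReal_mul, Complex.I_re, Complex.I_im]
  constructor <;> intro h <;> nlinarith

theorem InDisc.neg_inv {p q : ℝ} (hp : 0 < p) (hq : 0 < q) {w : ℂ} (hw : w ≠ 0)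
    (h : InDisc p q w) : InDisc p⁻¹ q⁻¹ (-w⁻¹) := by
  rw [inDisc_iff] at h ⊢
  have hn : 0 < Complex.normSq w := Complex.normSq_pos.2 hw
  rw [Complex.normSq_neg, Complex.normSq_inv, Complex.neg_im, Complex.inv_im]
  have : (Complex.normSq w)⁻¹ - (p⁻¹ + q⁻¹) * -(-w.im / Complex.normSq w) + p⁻¹ * q⁻¹
      = (Complex.normSq w - (p + q) * w.im + p * q) / (p * q * Complex.normSq w) := by
    field_simp
    ring
  rw [this]
  exact div_nonpos_of_nonpos_of_nonneg h (by positivity)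

/-- Centres always add. Radii add to the radius of the target disc because all the intervals are
oriented the same way, so `|∑ (b i - a i)| = ∑ |b i - a i|`. -/
theorem InDisc.sum {a b : ℕ → ℝ} {w : ℕ → ℂ} {N : ℕ}
    (hab : (∀ i, a i ≤ b i) ∨ ∀ i, b i ≤ a i) (h : ∀ i, InDisc (a i) (b i) (w i)) :
    InDisc (∑ i ∈ Finset.range N, a i) (∑ i ∈ Finset.range N, b i)
      (∑ i ∈ Finset.range N, w i) := by
  have h1 : |∑ i ∈ Finset.range N, b i - ∑ i ∈ Finset.range N, a i|
      = ∑ i ∈ Finset.range N, |b i - a i| := by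
    rw [← Finset.sum_sub_distrib]
    rcases hab with hab | hab
    · rw [abs_of_nonneg (Finset.sum_nonneg fun i _ => sub_nonneg.2 (hab i))]
      exact Finset.sum_congr rfl fun i _ => (abs_of_nonneg (sub_nonneg.2 (hab i))).symm
    · rw [abs_of_nonpos (Finset.sum_nonpos fun i _ => sub_nonpos.2 (hab i)),
        ← Finset.sum_neg_distrib]
      exact Finset.sum_congr rfl fun i _ => (abs_of_nonpos (sub_nonpos.2 (hab i))).symm
  rw [InDisc, h1, Finset.sum_div, ← Finset.sum_add_distrib, Finset.sum_div, Complex.ofReal_sum,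
    Finset.sum_mul, ← Finset.sum_sub_distrib]
  exact norm_sum_le_of_le _ fun i _ => h i

theorem InDisc.const_add {a b : ℝ} {w : ℂ} (h : InDisc a b w) (t : ℝ) :
    InDisc (t + a) (t + b) (t * Complex.I + w) := by
  rw [InDisc] at h ⊢
  convert h using 2
  · push_cast
    ring
  · congr 1
    ring

theorem InDisc.norm_sub_le {a b : ℝ} {w w' : ℂ} (h : InDisc a b w) (h' : InDisc a b w') :
    ‖w - w'‖ ≤ |b - a| := by
  rw [InDisc] at h h'
  have := _root_.norm_sub_le (w - ((a + b) / 2 : ℝ) * Complex.I)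
    (w' - ((a + b) / 2 : ℝ) * Complex.I)
  rw [sub_sub_sub_cancel_right] at this
  linarith

theorem imIter_le_or_le {t : ℝ} (ht : 0 < t) (n : ℕ) :
    (∀ ν, imIter t n ν ≤ imIter t (n + 1) ν) ∨ ∀ ν, imIter t (n + 1) ν ≤ imIter t n ν := by
  rcases Nat.even_or_odd' n with ⟨k, rfl | rfl⟩
  · exact Or.inl (imIter_even_le ht k 1)
  · exact Or.inr (imIter_le_odd ht k 1)

theorem inDisc_iter {t : ℝ} (ht : 0 < t) {z : ℍ} (hz : (z : ℂ) = t * Complex.I) (n : ℕ)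
    (ν : List ℕ → ℕ) (bd : List ℕ → HolSpace) :
    InDisc (imIter t n ν) (imIter t (n + 1) ν) (iter 0 (n + 1) ν bd z) := by
  induction n generalizing ν bd with
  | zero =>
    -- After one step the denominator has imaginary part at least `t` for any boundary values, and
    -- `w ↦ -w⁻¹` sends that half-plane into the disc with diameter from `0` to `i/t`.
    rw [iter, step_apply, inDisc_iff]
    have h0 := denominator_ne_zero (0 * (ν [] + 1)) (ν [])
      (fun i => iter 0 0 (shift i ν) (shift i bd)) z
    have h1 := im_le_im_denominator (0 * (ν [] + 1)) (ν [])
      (fun i => iter 0 0 (shift i ν) (shift i bd)) z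
    set w := (z : ℂ) + (0 * (ν [] + 1) : ℝ)
      + ∑ i ∈ Finset.range (ν []), iter 0 0 (shift i ν) (shift i bd) z
    have h2 : z.im = t := by
      rw [← coe_im, hz, Complex.im_ofReal_mul, Complex.I_im, mul_one]
    rw [h2] at h1
    have hn : 0 < Complex.normSq w := Complex.normSq_pos.2 h0
    simp only [imIter, Finset.sum_const_zero, add_zero, zero_add, zero_mul]
    rw [Complex.normSq_neg, Complex.normSq_inv, Complex.neg_im, Complex.inv_im, sub_nonpos,
      neg_div, neg_neg, ← div_eq_inv_mul, le_div_iff₀ ht, ← div_eq_inv_mul]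
    exact div_le_div_of_nonneg_right h1 hn.le
  | succ n ih =>
    rw [iter, step_apply]
    refine InDisc.neg_inv (imIter_denominator_pos ht _ _ fun i => shift i ν)
      (imIter_denominator_pos ht _ _ fun i => shift i ν) (denominator_ne_zero _ _ _ _) ?_
    rw [zero_mul, Complex.ofReal_zero, add_zero, hz]
    refine InDisc.const_add (InDisc.sum ?_ fun i => ih _ _) t
    exact (imIter_le_or_le ht n).imp (fun h i => h _) (fun h i => h _)

theorem forgetsAt_zero_of_tendsto {ν : List ℕ → ℕ}
    (h : ∀ k : ℕ, Tendsto (fun n => imIter (2 + 1 / (k + 1)) (n + 1) ν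
      - imIter (2 + 1 / (k + 1)) n ν) atTop (𝓝 0)) (z : ℍ) : ForgetsAt 0 ν z := by
  refine ForgetsAt.of_testPoint (fun k => ?_) z
  have ht : (0 : ℝ) < 2 + 1 / (k + 1) := by positivity
  have hb : ∀ f : HolSpace, ‖f (testPoint 0 k)‖ ≤ (2 + 1 / ((k : ℝ) + 1))⁻¹ := fun f => by
    simpa only [testPoint_im, one_div] using f.norm_le (testPoint 0 k)
  -- The disc estimate needs at least one step, so depth `0` gets the crude bound and depth `n ≥ 1`
  -- uses the disc of index `n - 1`.
  refine ForgetsAt.of_norm_le (δ := fun n => if n = 0 then 2 * (2 + 1 / ((k : ℝ) + 1))⁻¹ else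
    |imIter (2 + 1 / (k + 1)) (n - 1 + 1) ν - imIter (2 + 1 / (k + 1)) (n - 1) ν|) ?_ ?_
  · rw [← tendsto_add_atTop_iff_nat 1]
    simpa using (h k).abs
  · rintro (_ | n) bd bd'
    · simp only [if_true]
      linarith [norm_sub_le (iter 0 0 ν bd (testPoint 0 k)) (iter 0 0 ν bd' (testPoint 0 k)),
        hb (iter 0 0 ν bd), hb (iter 0 0 ν bd')]
    · have hz : (testPoint 0 k : ℂ) = ((2 + 1 / (k + 1) : ℝ) : ℂ) * Complex.I := by
        change ((0 : ℝ) : ℂ) + ((2 + 1 / (k + 1) : ℝ) : ℂ) * Complex.I = _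
        rw [Complex.ofReal_zero, zero_add]
      simpa using (inDisc_iter ht hz n ν bd).norm_sub_le (inDisc_iter ht hz n ν bd')

/-! ### Splitting product measures -/

/-- Under a product measure, a coordinate is independent of any family of other coordinates. -/
theorem measurePreserving_eval_prod_inj {ι E : Type*} {β : Type} [MeasurableSpace E]
    (μ : ι → Measure E) [∀ i, IsProbabilityMeasure (μ i)] {i₀ : ι} {f : β → ι}
    (hf : Function.Injective f) (hi : ∀ b, f b ≠ i₀) :
    MeasurePreserving (fun m : ι → E => (m i₀, fun b => m (f b))) (Measure.infinitePi μ)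
      ((μ i₀).prod (Measure.infinitePi fun b => μ (f b))) := by
  -- The selected coordinates are arranged in two blocks, a single point and `β`, so that currying
  -- the product measure exhibits the blocks as independent.
  let κ : Bool → Type := fun b => cond b β Unit
  let g : (Σ b, κ b) → ι := fun p => match p with
    | ⟨true, x⟩ => f x
    | ⟨false, _⟩ => i₀
  have hg : Function.Injective g := by
    rintro ⟨_ | _, x⟩ ⟨_ | _, y⟩ h
    · exact congrArg (Sigma.mk false) (Subsingleton.elim (α := Unit) x y)
    · exact absurd h.symm (hi _)
    · exact absurd h (hi _)
    · exact congrArg (Sigma.mk true) (hf h)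
  have h1 : MeasurePreserving (fun (m : ι → E) p => m (g p)) (Measure.infinitePi μ)
      (Measure.infinitePi fun p => μ (g p)) :=
    ⟨by fun_prop, Measure.map_infinitePi_infinitePi_of_inj (P := μ) hg⟩
  have h2 : MeasurePreserving (MeasurableEquiv.piCurry fun b (_ : κ b) => E)
      (Measure.infinitePi fun p => μ (g p))
      (Measure.infinitePi fun b => Measure.infinitePi fun j : κ b => μ (g ⟨b, j⟩)) :=
    ⟨MeasurableEquiv.measurable _,
      Measure.infinitePi_map_piCurry (X := fun b (_ : κ b) => E) fun b j => μ (g ⟨b, j⟩)⟩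
  have h3 : MeasurePreserving (fun ω : (b : Bool) → κ b → E => (ω false, ω true))
      (Measure.infinitePi fun b => Measure.infinitePi fun j : κ b => μ (g ⟨b, j⟩))
      ((Measure.infinitePi fun j : κ false => μ (g ⟨false, j⟩)).prod
        (Measure.infinitePi fun j : κ true => μ (g ⟨true, j⟩))) :=
    ⟨by fun_prop, Measure.infinitePi_map_eval_prod
      (P := fun b : Bool => Measure.infinitePi fun j : κ b => μ (g ⟨b, j⟩))
      (show false ≠ true by decide)⟩
  have h4 := measurePreserving_eval_infinitePi (fun j : κ false => μ (g ⟨false, j⟩)) ()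
  exact (h4.prod (MeasurePreserving.id
    (Measure.infinitePi fun j : κ true => μ (g ⟨true, j⟩)))).comp (h3.comp (h2.comp h1))

/-- The labels of the root and of the subtrees of its children are independent. -/
theorem measurePreserving_split {E : Type*} [MeasurableSpace E] (μ : List ℕ → Measure E)
    [∀ u, IsProbabilityMeasure (μ u)] :
    MeasurePreserving (fun m : List ℕ → E => (m [], fun i => shift i m)) (Measure.infinitePi μ)
      ((μ []).prod (Measure.infinitePi fun i => Measure.infinitePi fun u => μ (i :: u))) := by
  have h1 := measurePreserving_eval_prod_inj μ (i₀ := []) (f := fun p : ℕ × List ℕ => p.1 :: p.2)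
    (fun p q h => by
      have := List.cons.inj h
      exact Prod.ext this.1 this.2) (fun p => List.cons_ne_nil _ _)
  have h2 : MeasurePreserving (MeasurableEquiv.curry ℕ (List ℕ) E)
      (Measure.infinitePi fun p : ℕ × List ℕ => μ (p.1 :: p.2))
      (Measure.infinitePi fun i => Measure.infinitePi fun u => μ (i :: u)) :=
    ⟨MeasurableEquiv.measurable _, Measure.infinitePi_map_curry fun i u => μ (i :: u)⟩
  exact ((MeasurePreserving.id (μ [])).prod h2).comp h1

theorem measurePreserving_zero_succ {E : Type*} [MeasurableSpace E] (μ : Measure E)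
    [IsProbabilityMeasure μ] :
    MeasurePreserving (fun w : ℕ → E => (w 0, fun i => w (i + 1)))
      (Measure.infinitePi fun _ : ℕ => μ) (μ.prod (Measure.infinitePi fun _ : ℕ => μ)) :=
  measurePreserving_eval_prod_inj (fun _ : ℕ => μ) (f := fun i => i + 1) (add_left_injective 1)
    fun i => Nat.succ_ne_zero i

/-! ### The size-biasing identity -/

theorem measurable_natSum {W : Type*} [MeasurableSpace W] {y : W → ℝ} (hy : Measurable y) :
    Measurable fun p : ℕ × (ℕ → W) => ∑ i ∈ Finset.range p.1, y (p.2 i) := by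
  refine measurable_from_prod_countable_right fun n => ?_
  exact Finset.measurable_fun_sum (Finset.range n) fun i _ => hy.comp (measurable_pi_apply i)

/-- Split the numerator into its `k + 1` terms. By exchangeability all have the same integral as the
term of index `0`, and coordinate `0` is then separated as an independent variable `v`. -/
theorem lintegral_sum_div_eq {W : Type*} [MeasurableSpace W] (M : Measure W)
    [IsProbabilityMeasure M] {y : W → ℝ} (hy : Measurable y) (hy0 : ∀ v, 0 ≤ y v) {t : ℝ}
    (ht : 0 < t) (k : ℕ) :
    ∫⁻ w, ENNReal.ofReal ((∑ i ∈ Finset.range (k + 1), y (w i))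
        / (t + ∑ i ∈ Finset.range (k + 1), y (w i))) ∂(Measure.infinitePi fun _ : ℕ => M)
      = ((k + 1 : ℕ) : ℝ≥0∞) * ∫⁻ v, ∫⁻ w, ENNReal.ofReal (y v
        / (t + y v + ∑ i ∈ Finset.range k, y (w i)))
          ∂(Measure.infinitePi fun _ : ℕ => M) ∂M := by
  have hms : ∀ n, Measurable fun w : ℕ → W => ∑ i ∈ Finset.range n, y (w i) := fun n =>
    (measurable_natSum hy).comp measurable_prodMk_left
  have hs0 : ∀ n (w : ℕ → W), 0 ≤ ∑ i ∈ Finset.range n, y (w i) := fun n w =>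
    Finset.sum_nonneg fun i _ => hy0 _
  have h1 : ∀ w : ℕ → W, ENNReal.ofReal ((∑ i ∈ Finset.range (k + 1), y (w i))
        / (t + ∑ i ∈ Finset.range (k + 1), y (w i)))
      = ∑ j ∈ Finset.range (k + 1),
        ENNReal.ofReal (y (w j) / (t + ∑ i ∈ Finset.range (k + 1), y (w i))) := by
    intro w
    rw [Finset.sum_div, ENNReal.ofReal_sum_of_nonneg]
    exact fun i _ => div_nonneg (hy0 _) (add_nonneg ht.le (hs0 _ _))
  have hm : ∀ j, Measurable fun w : ℕ → W =>
      ENNReal.ofReal (y (w j) / (t + ∑ i ∈ Finset.range (k + 1), y (w i))) := fun j =>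
    ((hy.comp (measurable_pi_apply j)).div ((hms _).const_add t)).ennreal_ofReal
  simp_rw [h1]
  rw [lintegral_finsetSum _ fun j _ => hm j]
  have h2 : ∀ j ∈ Finset.range (k + 1),
      ∫⁻ w, ENNReal.ofReal (y (w j) / (t + ∑ i ∈ Finset.range (k + 1), y (w i)))
        ∂(Measure.infinitePi fun _ : ℕ => M)
      = ∫⁻ w, ENNReal.ofReal (y (w 0) / (t + ∑ i ∈ Finset.range (k + 1), y (w i)))
        ∂(Measure.infinitePi fun _ : ℕ => M) := by
    intro j hj
    have hp : MeasurePreserving (fun (w : ℕ → W) i => w (Equiv.swap 0 j i))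
        (Measure.infinitePi fun _ : ℕ => M) (Measure.infinitePi fun _ : ℕ => M) :=
      ⟨by fun_prop, Measure.map_infinitePi_infinitePi_of_inj (P := fun _ : ℕ => M)
        (Equiv.swap 0 j).injective⟩
    rw [← hp.lintegral_comp (hm 0)]
    refine lintegral_congr fun w => ?_
    simp only [Equiv.swap_apply_left]
    congr 3
    refine (Finset.sum_equiv (Equiv.swap 0 j) (fun i => ?_) fun i _ => rfl).symm
    rw [Finset.mem_range] at hj
    simp only [Finset.mem_range, Equiv.swap_apply_def]
    split_ifs <;> omega
  rw [Finset.sum_congr rfl h2, Finset.sum_const, Finset.card_range, nsmul_eq_mul]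
  congr 1
  have hmp : Measurable fun q : W × (ℕ → W) =>
      ENNReal.ofReal (y q.1 / (t + y q.1 + ∑ i ∈ Finset.range k, y (q.2 i))) :=
    ((hy.comp measurable_fst).div (((hy.comp measurable_fst).const_add t).add
      ((hms k).comp measurable_snd))).ennreal_ofReal
  rw [← lintegral_prod _ hmp.aemeasurable, ← (measurePreserving_zero_succ M).lintegral_comp hmp]
  refine lintegral_congr fun w => ?_
  rw [Finset.sum_range_succ', add_assoc t, add_comm (y (w 0))]

theorem lintegral_pmf_prod {W : Type*} [MeasurableSpace W] (L : PMF ℕ) (M : Measure W)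
    [SFinite M] {f : ℕ × W → ℝ≥0∞} (hf : Measurable f) :
    ∫⁻ p, f p ∂(L.toMeasure.prod M) = ∑' k, L k * ∫⁻ w, f (k, w) ∂M := by
  rw [lintegral_prod _ hf.aemeasurable, lintegral_countable']
  refine tsum_congr fun k => ?_
  rw [PMF.toMeasure_apply_singleton _ _ (measurableSet_singleton k), mul_comm]

theorem mean_mul_offspringLaw (Fs : PMF ℕ) (h0 : mean Fs ≠ 0) (htop : mean Fs ≠ ∞) (k : ℕ) :
    mean Fs * offspringLaw Fs h0 htop k = ((k + 1 : ℕ) : ℝ≥0∞) * Fs (k + 1) :=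
  ENNReal.mul_div_cancel h0 htop

/-- Conditioning on the degree `k + 1`, exchangeability produces a factor `k + 1`, and `(k + 1)
F_*(k + 1) = m F(k)` turns the root law into `F`. Degree `0` contributes nothing. -/
theorem lintegral_sizeBias (Fs : PMF ℕ) (h0 : mean Fs ≠ 0) (htop : mean Fs ≠ ∞) {W : Type*}
    [MeasurableSpace W] (M : Measure W) [IsProbabilityMeasure M] {y : W → ℝ} (hy : Measurable y)
    (hy0 : ∀ v, 0 ≤ y v) {t : ℝ} (ht : 0 < t) :
    ∫⁻ p, ENNReal.ofReal ((∑ i ∈ Finset.range p.1, y (p.2 i))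
        / (t + ∑ i ∈ Finset.range p.1, y (p.2 i)))
        ∂(Fs.toMeasure.prod (Measure.infinitePi fun _ : ℕ => M))
      = mean Fs * ∫⁻ v, ∫⁻ p, ENNReal.ofReal (y v
        / (t + y v + ∑ i ∈ Finset.range p.1, y (p.2 i)))
          ∂((offspringLaw Fs h0 htop).toMeasure.prod (Measure.infinitePi fun _ : ℕ => M)) ∂M := by
  have hS := measurable_natSum hy
  have hmv : ∀ v, Measurable fun p : ℕ × (ℕ → W) => ENNReal.ofReal (y v
        / (t + y v + ∑ i ∈ Finset.range p.1, y (p.2 i))) := fun v =>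
    (measurable_const.div (hS.const_add _)).ennreal_ofReal
  have hmk : ∀ k, Measurable fun q : W × (ℕ → W) => ENNReal.ofReal (y q.1
        / (t + y q.1 + ∑ i ∈ Finset.range k, y (q.2 i))) := fun k =>
    ((hy.comp measurable_fst).div (((hy.comp measurable_fst).const_add t).add
      ((hS.comp measurable_prodMk_left).comp measurable_snd))).ennreal_ofReal
  have hm : Measurable fun p : ℕ × (ℕ → W) => ENNReal.ofReal ((∑ i ∈ Finset.range p.1, y (p.2 i))
        / (t + ∑ i ∈ Finset.range p.1, y (p.2 i))) := (hS.div (hS.const_add t)).ennreal_ofReal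
  rw [lintegral_pmf_prod Fs _ hm]
  rw [lintegral_congr fun v => lintegral_pmf_prod (offspringLaw Fs h0 htop)
    (Measure.infinitePi fun _ : ℕ => M) (hmv v)]
  rw [lintegral_tsum fun k => ((hmk k).lintegral_prod_right'.const_mul _).aemeasurable,
    ← ENNReal.tsum_mul_left, tsum_eq_zero_add' ENNReal.summable]
  simp only [Finset.range_zero, Finset.sum_empty, zero_div, ENNReal.ofReal_zero, lintegral_zero,
    mul_zero, zero_add]
  refine tsum_congr fun k => ?_
  rw [lintegral_sum_div_eq M hy hy0 ht, lintegral_const_mul _ (hmk k).lintegral_prod_right',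
    ← mul_assoc, ← mul_assoc, mean_mul_offspringLaw, mul_comm (Fs (k + 1))]

/-! ### The two limits of the recursion on the imaginary half-line agree -/

/-- The law of the offspring numbers of a Galton-Watson tree with offspring law `L`. -/
noncomputable def gwLaw (L : PMF ℕ) : Measure (List ℕ → ℕ) :=
  Measure.infinitePi fun _ : List ℕ => L.toMeasure

noncomputable instance (L : PMF ℕ) : IsProbabilityMeasure (gwLaw L) := by
  unfold gwLaw
  infer_instance

theorem measurePreserving_gwLaw (L : PMF ℕ) :
    MeasurePreserving (fun ν : List ℕ → ℕ => (ν [], fun i => shift i ν)) (gwLaw L)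
      (L.toMeasure.prod (Measure.infinitePi fun _ : ℕ => gwLaw L)) :=
  measurePreserving_split fun _ : List ℕ => L.toMeasure

theorem measurable_shift {E : Type*} [MeasurableSpace E] (i : ℕ) :
    Measurable (shift i : (List ℕ → E) → List ℕ → E) :=
  measurable_pi_lambda _ fun _ => measurable_pi_apply _

theorem measurable_imIter (t : ℝ) (n : ℕ) : Measurable (imIter t n) := by
  induction n with
  | zero => exact measurable_const
  | succ n ih =>
    have h1 : Measurable fun ν : List ℕ → ℕ => (ν [], fun i => shift i ν) :=
      (measurable_pi_apply _).prodMk (measurable_pi_lambda _ fun i => measurable_shift i)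
    exact (((measurable_natSum ih).comp h1).const_add t).inv

/-- The limit of the even iterates of the recursion on the imaginary half-line. -/
noncomputable def imLower (t : ℝ) (ν : List ℕ → ℕ) : ℝ := ⨆ k : ℕ, imIter t (2 * k) ν

/-- The limit of the odd iterates of the recursion on the imaginary half-line. -/
noncomputable def imUpper (t : ℝ) (ν : List ℕ → ℕ) : ℝ := ⨅ k : ℕ, imIter t (2 * k + 1) ν

theorem measurable_imLower (t : ℝ) : Measurable (imLower t) :=
  Measurable.iSup fun _ => measurable_imIter t _

theorem measurable_imUpper (t : ℝ) : Measurable (imUpper t) :=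
  Measurable.iInf fun _ => measurable_imIter t _

theorem tendsto_imLower {t : ℝ} (ht : 0 < t) (ν : List ℕ → ℕ) :
    Tendsto (fun k => imIter t (2 * k) ν) atTop (𝓝 (imLower t ν)) := by
  refine tendsto_atTop_ciSup (monotone_nat_of_le_succ fun k => imIter_even_le ht k 2 ν) ⟨t⁻¹, ?_⟩
  rintro _ ⟨k, rfl⟩
  exact imIter_le ht _ _

theorem tendsto_imUpper {t : ℝ} (ht : 0 < t) (ν : List ℕ → ℕ) :
    Tendsto (fun k => imIter t (2 * k + 1) ν) atTop (𝓝 (imUpper t ν)) := by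
  refine tendsto_atTop_ciInf (antitone_nat_of_succ_le fun k => imIter_le_odd ht k 2 ν) ⟨0, ?_⟩
  rintro _ ⟨k, rfl⟩
  exact imIter_nonneg ht _ _

theorem imLower_nonneg {t : ℝ} (ht : 0 < t) (ν : List ℕ → ℕ) : 0 ≤ imLower t ν :=
  ge_of_tendsto' (tendsto_imLower ht ν) fun _ => imIter_nonneg ht _ _

theorem imLower_le_imUpper {t : ℝ} (ht : 0 < t) (ν : List ℕ → ℕ) : imLower t ν ≤ imUpper t ν :=
  le_of_tendsto_of_tendsto' (tendsto_imLower ht ν) (tendsto_imUpper ht ν) fun k =>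
    imIter_even_le ht k 1 ν

theorem imUpper_nonneg {t : ℝ} (ht : 0 < t) (ν : List ℕ → ℕ) : 0 ≤ imUpper t ν :=
  (imLower_nonneg ht ν).trans (imLower_le_imUpper ht ν)

theorem imUpper_eq {t : ℝ} (ht : 0 < t) (ν : List ℕ → ℕ) :
    imUpper t ν = (t + ∑ i ∈ Finset.range (ν []), imLower t (shift i ν))⁻¹ := by
  refine tendsto_nhds_unique (tendsto_imUpper ht ν) ?_
  exact ((tendsto_finsetSum _ fun i _ => tendsto_imLower ht (shift i ν)).const_add t).inv₀
    (add_pos_of_pos_of_nonneg ht (Finset.sum_nonneg fun i _ => imLower_nonneg ht _)).ne'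

theorem imLower_eq {t : ℝ} (ht : 0 < t) (ν : List ℕ → ℕ) :
    imLower t ν = (t + ∑ i ∈ Finset.range (ν []), imUpper t (shift i ν))⁻¹ := by
  refine tendsto_nhds_unique ((tendsto_imLower ht ν).comp (tendsto_add_atTop_nat 1)) ?_
  exact ((tendsto_finsetSum _ fun i _ => tendsto_imUpper ht (shift i ν)).const_add t).inv₀
    (add_pos_of_pos_of_nonneg ht (Finset.sum_nonneg fun i _ => imUpper_nonneg ht _)).ne'

/-- The point is that the integrand on the right depends only on the product `x v' * y v`, hence is
symmetric when the roles of `x` and `y` are exchanged. -/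
theorem lintegral_sizeBias_gwLaw (Fs : PMF ℕ) (h0 : mean Fs ≠ 0) (htop : mean Fs ≠ ∞)
    {x y : (List ℕ → ℕ) → ℝ} (hy : Measurable y) (hy0 : ∀ v, 0 ≤ y v) {t : ℝ} (ht : 0 < t)
    (hx : ∀ ν, x ν = (t + ∑ i ∈ Finset.range (ν []), y (shift i ν))⁻¹) :
    ∫⁻ p, ENNReal.ofReal ((∑ i ∈ Finset.range p.1, y (p.2 i))
        / (t + ∑ i ∈ Finset.range p.1, y (p.2 i)))
        ∂(Fs.toMeasure.prod (Measure.infinitePi fun _ : ℕ => gwLaw (offspringLaw Fs h0 htop)))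
      = mean Fs * ∫⁻ v, ∫⁻ v', ENNReal.ofReal (x v' * y v / (1 + x v' * y v))
          ∂gwLaw (offspringLaw Fs h0 htop) ∂gwLaw (offspringLaw Fs h0 htop) := by
  rw [lintegral_sizeBias Fs h0 htop _ hy hy0 ht]
  congr 1
  refine lintegral_congr fun v => ?_
  have hm : Measurable fun p : ℕ × (ℕ → List ℕ → ℕ) => ENNReal.ofReal (y v
        / (t + y v + ∑ i ∈ Finset.range p.1, y (p.2 i))) :=
    (measurable_const.div ((measurable_natSum hy).const_add _)).ennreal_ofReal
  rw [← (measurePreserving_gwLaw _).lintegral_comp hm]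
  refine lintegral_congr fun v' => ?_
  rw [hx v']
  have hS : 0 ≤ ∑ i ∈ Finset.range (v' []), y (shift i v') := Finset.sum_nonneg fun i _ => hy0 _
  have h1 := hy0 v
  have h2 : t + ∑ i ∈ Finset.range (v' []), y (shift i v') ≠ 0 := by positivity
  have h3 : t + y v + ∑ i ∈ Finset.range (v' []), y (shift i v') ≠ 0 := by positivity
  have h4 : t + (∑ i ∈ Finset.range (v' []), y (shift i v')) + y v ≠ 0 := by positivity
  congr 1
  field_simp
  ring

theorem exists_pos_of_mean_ne_zero {Fs : PMF ℕ} (h0 : mean Fs ≠ 0) : ∃ k, Fs (k + 1) ≠ 0 := by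
  by_contra! h
  refine h0 (ENNReal.tsum_eq_zero.2 fun k => ?_)
  cases k with
  | zero => simp
  | succ k => rw [h k, mul_zero]

theorem ae_imLower_eq_imUpper (Fs : PMF ℕ) (h0 : mean Fs ≠ 0) (htop : mean Fs ≠ ∞) {t : ℝ}
    (ht : 0 < t) : ∀ᵐ ν ∂gwLaw (offspringLaw Fs h0 htop), imLower t ν = imUpper t ν := by
  set M := gwLaw (offspringLaw Fs h0 htop) with hM
  have hl := lintegral_sizeBias_gwLaw Fs h0 htop (measurable_imLower t) (imLower_nonneg ht) ht
    (imUpper_eq ht)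
  have hu := lintegral_sizeBias_gwLaw Fs h0 htop (measurable_imUpper t) (imUpper_nonneg ht) ht
    (imLower_eq ht)
  rw [← hM] at hl hu
  have hmK : Measurable fun q : (List ℕ → ℕ) × (List ℕ → ℕ) =>
      ENNReal.ofReal (imUpper t q.2 * imLower t q.1 / (1 + imUpper t q.2 * imLower t q.1)) := by
    have h1 : Measurable fun q : (List ℕ → ℕ) × (List ℕ → ℕ) => imUpper t q.2 * imLower t q.1 :=
      ((measurable_imUpper t).comp measurable_snd).mul ((measurable_imLower t).comp measurable_fst)
    exact (h1.div (h1.const_add 1)).ennreal_ofReal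
  rw [lintegral_lintegral_swap hmK.aemeasurable] at hl
  simp_rw [mul_comm (imLower t _)] at hu
  set S : (((List ℕ → ℕ)) → ℝ) → ℕ × (ℕ → List ℕ → ℕ) → ℝ :=
    fun y p => ∑ i ∈ Finset.range p.1, y (p.2 i) with hS
  have hSm : ∀ {y : (List ℕ → ℕ) → ℝ}, Measurable y →
      Measurable fun p => ENNReal.ofReal (S y p / (t + S y p)) := fun hy =>
    ((measurable_natSum hy).div ((measurable_natSum hy).const_add t)).ennreal_ofReal
  have hle : ∀ p, S (imLower t) p ≤ S (imUpper t) p := fun p =>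
    Finset.sum_le_sum fun i _ => imLower_le_imUpper ht _
  have hl0 : ∀ p, 0 ≤ S (imLower t) p := fun p => Finset.sum_nonneg fun i _ => imLower_nonneg ht _
  have hu0 : ∀ p, 0 ≤ S (imUpper t) p := fun p => (hl0 p).trans (hle p)
  have hfin : ∫⁻ p, ENNReal.ofReal (S (imLower t) p / (t + S (imLower t) p))
      ∂(Fs.toMeasure.prod (Measure.infinitePi fun _ : ℕ => M)) ≠ ∞ := by
    refine ne_top_of_le_ne_top ENNReal.one_ne_top ((lintegral_mono fun p => ?_).trans_eq
      (lintegral_one.trans measure_univ))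
    rw [← ENNReal.ofReal_one]
    exact ENNReal.ofReal_le_ofReal (div_le_one_of_le₀ (by linarith) (by linarith [hl0 p]))
  -- Pointwise ordered integrands with equal finite integrals agree almost everywhere.
  have hae := ae_eq_of_ae_le_of_lintegral_le
    (μ := Fs.toMeasure.prod (Measure.infinitePi fun _ : ℕ => M))
    (f := fun p => ENNReal.ofReal (S (imLower t) p / (t + S (imLower t) p)))
    (g := fun p => ENNReal.ofReal (S (imUpper t) p / (t + S (imUpper t) p)))
    (Eventually.of_forall fun p => ENNReal.ofReal_le_ofReal (by
      rw [div_le_div_iff₀ (by linarith [hl0 p]) (by linarith [hu0 p])]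
      nlinarith [hle p])) hfin (hSm (measurable_imUpper t)).aemeasurable (hu.trans hl.symm).le
  obtain ⟨k, hk⟩ := exists_pos_of_mean_ne_zero h0
  have hk' : ∀ᵐ w ∂(Measure.infinitePi fun _ : ℕ => M),
      S (imLower t) (k + 1, w) = S (imUpper t) (k + 1, w) := by
    have h1 := (ae_iff_of_countable.1 (Measure.ae_ae_of_ae_prod hae)) (k + 1)
      (by rwa [PMF.toMeasure_apply_singleton _ _ (measurableSet_singleton _)])
    filter_upwards [h1] with w hw
    have hlp : 0 < t + S (imLower t) (k + 1, w) := by linarith [hl0 (k + 1, w)]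
    have hup : 0 < t + S (imUpper t) (k + 1, w) := by linarith [hu0 (k + 1, w)]
    rw [ENNReal.ofReal_eq_ofReal_iff (div_nonneg (hl0 _) hlp.le) (div_nonneg (hu0 _) hup.le),
      div_eq_div_iff hlp.ne' hup.ne'] at hw
    nlinarith
  have h2 : ∀ᵐ w ∂(Measure.infinitePi fun _ : ℕ => M), imLower t (w 0) = imUpper t (w 0) := by
    filter_upwards [hk'] with w hw
    -- Termwise ordered sums that agree have equal terms; index `0` is present because the chosen
    -- degree `k + 1` is positive.
    exact (Finset.sum_eq_sum_iff_of_le fun i _ => imLower_le_imUpper ht (w i)).1 hw 0 (by simp)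
  have h3 := measurePreserving_eval_infinitePi (fun _ : ℕ => M) 0
  rw [← h3.map_eq]
  exact (ae_map_iff h3.measurable.aemeasurable
    (measurableSet_eq_fun (measurable_imLower t) (measurable_imUpper t))).2 h2

theorem tendsto_imIter_sub {t : ℝ} (ht : 0 < t) {ν : List ℕ → ℕ}
    (h : imLower t ν = imUpper t ν) :
    Tendsto (fun n => imIter t (n + 1) ν - imIter t n ν) atTop (𝓝 0) := by
  have h1 : Tendsto (fun k => imIter t (2 * k + 1) ν - imIter t (2 * k) ν) atTop (𝓝 0) := by
    have := (tendsto_imUpper ht ν).sub (tendsto_imLower ht ν)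
    rwa [h, sub_self] at this
  -- By nesting, the gap after step `n` is at most the gap between the iterates `2k` and `2k + 1`
  -- with `k = n / 2`.
  refine squeeze_zero_norm (fun n => ?_) (h1.comp (Nat.tendsto_div_const_atTop two_ne_zero))
  rw [Real.norm_eq_abs, Function.comp_apply]
  rcases Nat.even_or_odd' n with ⟨k, rfl | rfl⟩
  · rw [Nat.mul_div_cancel_left k two_pos, abs_of_nonneg (sub_nonneg.2 (imIter_even_le ht k 1 ν))]
  · rw [show (2 * k + 1) / 2 = k by omega, abs_of_nonpos (sub_nonpos.2 (imIter_le_odd ht k 1 ν))]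
    linarith [imIter_even_le ht k 2 ν]

theorem ae_forgetsAt {α : ℝ} (hα : α = 0 ∨ α = 1) (Fs : PMF ℕ) (h0 : mean Fs ≠ 0)
    (htop : mean Fs ≠ ∞) :
    ∀ᵐ ν ∂gwLaw (offspringLaw Fs h0 htop), ∀ z, ForgetsAt α ν z := by
  rcases hα with rfl | rfl
  · have h1 : ∀ k : ℕ, ∀ᵐ ν ∂gwLaw (offspringLaw Fs h0 htop),
        imLower (2 + 1 / ((k : ℝ) + 1)) ν = imUpper (2 + 1 / ((k : ℝ) + 1)) ν := fun k =>
      ae_imLower_eq_imUpper Fs h0 htop (by positivity)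
    filter_upwards [ae_all_iff.2 h1] with ν hν z
    exact forgetsAt_zero_of_tendsto (fun k => tendsto_imIter_sub (by positivity) (hν k)) z
  · exact Eventually.of_forall fun ν z => forgetsAt_one ν z

/-! ### The solution of the recursive distributional equation -/

/-- A placeholder: `leaf` sums over no children and never evaluates it, and `gwLimit` takes this
value only where the limit does not exist. -/
noncomputable instance : Inhabited HolSpace where
  default :=
    { toFun := fun z => -(z : ℂ)⁻¹
      holomorphic := by
        rw [UpperHalfPlane.mdifferentiable_iff]
        have hz : DifferentiableOn ℂ (fun w : ℂ => (ofComplex w : ℂ)) {w | 0 < w.im} :=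
          UpperHalfPlane.mdifferentiable_iff.1 mdifferentiable_coe
        exact (hz.inv fun w _ => UpperHalfPlane.ne_zero _).neg
      im_pos := fun z => by
        rw [Complex.neg_im, Complex.inv_im, neg_div, neg_neg]
        exact div_pos z.im_pos (Complex.normSq_pos.2 z.ne_zero)
      norm_le := fun z => by
        rw [norm_neg, norm_inv, ← one_div]
        exact one_div_le_one_div_of_le z.im_pos
          ((le_abs_self _).trans (Complex.abs_im_le_norm (z : ℂ))) }

/-- The root value of a leaf. -/
noncomputable def leaf (α : ℝ) : HolSpace := step α 0 default

/-- The root values of the truncated trees. -/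
noncomputable def truncated (α : ℝ) (n : ℕ) (ν : List ℕ → ℕ) : HolSpace :=
  iter α n ν fun _ => leaf α

/-- The recursion along a tree whose vertices carry offspring numbers and boundary values. -/
noncomputable def markedIter (α : ℝ) (n : ℕ) (m : List ℕ → ℕ × HolSpace) : HolSpace :=
  iter α n (fun u => (m u).1) fun u => (m u).2

theorem markedIter_succ (α : ℝ) (n : ℕ) (m : List ℕ → ℕ × HolSpace) :
    markedIter α (n + 1) m
      = step (α * ((m []).1 + 1)) (m []).1 fun i => markedIter α n (shift i m) := rfl

theorem measurable_markedIter (α : ℝ) (n : ℕ) : Measurable (markedIter α n) := by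
  induction n with
  | zero => exact measurable_snd.comp (measurable_pi_apply [])
  | succ n ih =>
    have h1 : Measurable fun m : List ℕ → ℕ × HolSpace =>
        ((m []).1, fun i => markedIter α n (shift i m)) :=
      Measurable.prodMk (measurable_fst.comp (measurable_pi_apply []))
        (measurable_pi_lambda _ fun i => ih.comp (measurable_shift i))
    have h2 := (measurable_step fun k => α * (k + 1)).comp h1
    rw [show markedIter α (n + 1) = _ from funext (markedIter_succ α n)]
    exact h2

theorem measurable_truncated (α : ℝ) (n : ℕ) : Measurable (truncated α n) :=
  (measurable_markedIter α n).comp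
    (measurable_pi_lambda _ fun u => (measurable_pi_apply u).prodMk measurable_const)

/-- `Im(-1/D) = Im D / |D|^2`, and `|D|` is bounded because each `|h i z| ≤ 1 / Im z`. Uniformity in
`h` keeps limits of the recursion off the real axis, as `HolSpace.exists_limit` requires. -/
theorem exists_pos_le_im_step (a : ℝ) (n : ℕ) (z : ℍ) :
    ∃ c > 0, ∀ h : ℕ → HolSpace, c ≤ (step a n h z).im := by
  refine ⟨z.im / (‖(z : ℂ)‖ + |a| + n * (1 / z.im)) ^ 2, ?_, fun h => ?_⟩
  · have h1 := z.im_pos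
    have h2 : 0 < ‖(z : ℂ)‖ := norm_pos_iff.2 z.ne_zero
    positivity
  · have h1 := im_le_im_denominator a n h z
    have h0 := denominator_ne_zero a n h z
    have h2 : ‖(z : ℂ) + a + ∑ i ∈ Finset.range n, h i z‖
        ≤ ‖(z : ℂ)‖ + |a| + n * (1 / z.im) := by
      have h3 : ‖∑ i ∈ Finset.range n, h i z‖ ≤ n * (1 / z.im) := by
        simpa using norm_sum_le_of_le (Finset.range n) fun i _ => (h i).norm_le z
      have h4 := norm_add₃_le (a := (z : ℂ)) (b := a) (c := ∑ i ∈ Finset.range n, h i z)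
      rw [Complex.norm_real, Real.norm_eq_abs] at h4
      linarith
    rw [step_apply, Complex.neg_im, Complex.inv_im, neg_div, neg_neg, Complex.normSq_eq_norm_sq]
    exact div_le_div₀ (z.im_pos.le.trans h1) h1 (by positivity)
      (pow_le_pow_left₀ (norm_nonneg _) h2 2)

/-- Vitali's theorem is applied to pairs of depths, which gives the Cauchy property at every `z`.
Since only countably many points are tested, the convergence set is measurable. -/
theorem exists_tendsto_truncated {α : ℝ} {ν : List ℕ → ℕ}
    (h : ∀ k, ∃ l, Tendsto (fun n => truncated α n ν (testPoint α k)) atTop (𝓝 l)) :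
    ∃ g : HolSpace, ∀ z, Tendsto (fun n => truncated α n ν z) atTop (𝓝 (g z)) := by
  have h1 : ∀ z, Tendsto (fun p : ℕ × ℕ => truncated α p.1 ν z - truncated α p.2 ν z) atTop
      (𝓝 0) := by
    refine HolSpace.tendsto_sub_of_accumulation (f := fun p : ℕ × ℕ => truncated α p.1 ν)
      (g := fun p => truncated α p.2 ν) (tendsto_testPoint α) (testPoint_ne α) fun k => ?_
    obtain ⟨l, hl⟩ := h k
    rw [← prod_atTop_atTop_eq]
    simpa using (hl.comp tendsto_fst).sub (hl.comp tendsto_snd)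
  have h2 : ∀ z, ∃ l, Tendsto (fun n => truncated α n ν z) atTop (𝓝 l) := fun z => by
    refine cauchySeq_tendsto_of_complete (cauchySeq_iff_tendsto_dist_atTop_0.2 ?_)
    simpa only [dist_eq_norm, norm_zero] using (h1 z).norm
  choose F hF using h2
  obtain ⟨g, hg⟩ := HolSpace.exists_limit hF fun z => by
    obtain ⟨c, hc, hle⟩ := exists_pos_le_im_step (α * (ν [] + 1)) (ν []) z
    refine hc.trans_le (ge_of_tendsto
      ((Complex.continuous_im.tendsto _).comp ((hF z).comp (tendsto_add_atTop_nat 1)))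
      (Eventually.of_forall fun n => hle _))
  exact ⟨g, fun z => by rw [hg]; exact hF z⟩

open scoped Classical in
/-- The limit of the root values of the truncated trees. -/
noncomputable def gwLimit (α : ℝ) (ν : List ℕ → ℕ) : HolSpace :=
  if h : ∃ g : HolSpace, ∀ z, Tendsto (fun n => truncated α n ν z) atTop (𝓝 (g z)) then h.choose
  else default

theorem measurable_gwLimit (α : ℝ) : Measurable (gwLimit α) := by
  classical
  set G : Set (List ℕ → ℕ) :=
    {ν | ∃ g : HolSpace, ∀ z, Tendsto (fun n => truncated α n ν z) atTop (𝓝 (g z))} with hG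
  have hGm : MeasurableSet G := by
    have h1 : G = ⋂ k, {ν | ∃ l, Tendsto (fun n => truncated α n ν (testPoint α k)) atTop
        (𝓝 l)} := by
      ext ν
      rw [Set.mem_iInter]
      exact ⟨fun ⟨g, hg⟩ k => ⟨_, hg _⟩, exists_tendsto_truncated⟩
    rw [h1]
    exact MeasurableSet.iInter fun k => measurableSet_exists_tendsto
      fun n => (measurable_eval _).comp (measurable_truncated α n)
  refine measurable_of_eval fun z => ?_
  refine measurable_of_tendsto_metrizable
    (f := fun n ν => if ν ∈ G then truncated α n ν z else (default : HolSpace) z)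
    (fun n => Measurable.ite hGm ((measurable_eval z).comp (measurable_truncated α n))
      measurable_const) ?_
  rw [tendsto_pi_nhds]
  intro ν
  by_cases hν : ν ∈ G
  · simp only [hν, if_true]
    have hν' : ∃ g : HolSpace, ∀ z, Tendsto (fun n => truncated α n ν z) atTop (𝓝 (g z)) := hν
    rw [gwLimit, dif_pos hν']
    exact hν'.choose_spec z
  · simp only [hν, if_false]
    have hν' : ¬∃ g : HolSpace, ∀ z, Tendsto (fun n => truncated α n ν z) atTop (𝓝 (g z)) := hν
    rw [gwLimit, dif_neg hν']
    exact tendsto_const_nhds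

theorem ForgetsAt.eventually_dist_lt {α : ℝ} {ν : List ℕ → ℕ} {z : ℍ} (h : ForgetsAt α ν z)
    {ε : ℝ} (hε : 0 < ε) :
    ∀ᶠ n in atTop, ∀ bd bd', dist (iter α n ν bd z) (iter α n ν bd' z) < ε := by
  have h1 := Metric.tendsto_nhds.1 h ε hε
  obtain ⟨pa, ha, pb, hb, hp⟩ := eventually_prod_iff.1 h1
  rw [eventually_top] at hb
  filter_upwards [ha] with n hn bd bd'
  have := hp hn (hb (bd, bd'))
  rwa [dist_zero_right, ← dist_eq_norm] at this

theorem tendsto_iter {α : ℝ} {ν : List ℕ → ℕ} (h : ∀ z, ForgetsAt α ν z)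
    (bd : ℕ → List ℕ → HolSpace) (z : ℍ) :
    Tendsto (fun n => iter α n ν (bd n) z) atTop (𝓝 (gwLimit α ν z)) := by
  have h1 : ∃ g : HolSpace, ∀ z, Tendsto (fun n => truncated α n ν z) atTop (𝓝 (g z)) := by
    refine exists_tendsto_truncated fun k => ?_
    refine cauchySeq_tendsto_of_complete (Metric.cauchySeq_iff'.2 fun ε hε => ?_)
    obtain ⟨N, hN⟩ := eventually_atTop.1 ((h (testPoint α k)).eventually_dist_lt hε)
    refine ⟨N, fun n hn => ?_⟩
    obtain ⟨j, rfl⟩ := Nat.exists_eq_add_of_le hn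
    rw [truncated, iter_add]
    exact hN N le_rfl _ _
  have h2 : Tendsto (fun n => truncated α n ν z) atTop (𝓝 (gwLimit α ν z)) := by
    rw [gwLimit, dif_pos h1]
    exact h1.choose_spec z
  refine h2.congr_dist (Metric.tendsto_nhds.2 fun ε hε => ?_)
  filter_upwards [(h z).eventually_dist_lt hε] with n hn
  rw [Real.dist_0_eq_abs, abs_of_nonneg dist_nonneg]
  exact hn _ _

theorem gwLimit_eq_step {α : ℝ} {ν : List ℕ → ℕ} (h : ∀ z, ForgetsAt α ν z)
    (hs : ∀ i z, ForgetsAt α (shift i ν) z) :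
    gwLimit α ν = step (α * (ν [] + 1)) (ν []) fun i => gwLimit α (shift i ν) := by
  ext z
  refine tendsto_nhds_unique
    ((tendsto_iter h (fun _ _ => leaf α) z).comp (tendsto_add_atTop_nat 1)) ?_
  exact (((tendsto_finsetSum _ fun i _ => tendsto_iter (hs i) (fun _ _ => leaf α) z).const_add
    _).inv₀ (denominator_ne_zero _ _ (fun i => gwLimit α (shift i ν)) z)).neg

/-- The law of `gwLimit` along a Galton-Watson tree with offspring law `L`. -/
noncomputable def limitLaw (α : ℝ) (L : PMF ℕ) : ProbabilityMeasure HolSpace :=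
  ⟨(gwLaw L).map (gwLimit α),
    Measure.isProbabilityMeasure_map (measurable_gwLimit α).aemeasurable⟩

theorem measurePreserving_inputLaw (α : ℝ) (L L' : PMF ℕ) :
    MeasurePreserving
      (fun p : ℕ × (ℕ → List ℕ → ℕ) => (p.1, fun i => gwLimit α (p.2 i)))
      (L'.toMeasure.prod (Measure.infinitePi fun _ : ℕ => gwLaw L))
      (inputLaw L' (limitLaw α L)) := by
  have h1 : MeasurePreserving (fun (w : ℕ → List ℕ → ℕ) i => gwLimit α (w i))
      (Measure.infinitePi fun _ : ℕ => gwLaw L)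
      (Measure.infinitePi fun _ : ℕ => (limitLaw α L : Measure HolSpace)) :=
    ⟨measurable_pi_lambda _ fun i => (measurable_gwLimit α).comp (measurable_pi_apply i),
      Measure.infinitePi_map_pi _ fun _ => measurable_gwLimit α⟩
  exact (MeasurePreserving.id L'.toMeasure).prod h1

theorem measurePreserving_shift {E : Type*} [MeasurableSpace E] (μ : Measure E)
    [IsProbabilityMeasure μ] (i : ℕ) :
    MeasurePreserving (shift i) (Measure.infinitePi fun _ : List ℕ => μ)
      (Measure.infinitePi fun _ : List ℕ => μ) :=
  ⟨measurable_shift i, Measure.map_infinitePi_infinitePi_of_inj (P := fun _ : List ℕ => μ)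
    (List.cons_injective (a := i))⟩

theorem isRDESolution_limitLaw {α : ℝ} {L : PMF ℕ}
    (h : ∀ᵐ ν ∂gwLaw L, ∀ z, ForgetsAt α ν z) : IsRDESolution α L (limitLaw α L) := by
  have hs : ∀ᵐ ν ∂gwLaw L, ∀ i z, ForgetsAt α (shift i ν) z :=
    ae_all_iff.2 fun i => (measurePreserving_shift L.toMeasure i).quasiMeasurePreserving.ae h
  have h1 := (measurePreserving_inputLaw α L L).comp (measurePreserving_gwLaw L)
  rw [IsRDESolution, ← h1.map_eq,
    Measure.map_map (measurable_step fun k => α * (k + 1)) h1.measurable]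
  refine Measure.map_congr ?_
  filter_upwards [h, hs] with ν hν hsν
  exact gwLimit_eq_step hν hsν

/-! ### Uniqueness of the solution -/

/-- Each generation applies the recursive equation once: the subtrees of the children carry
independent root values of law `Q`, and these are independent of the offspring number. -/
theorem measurePreserving_markedIter {α : ℝ} {L : PMF ℕ} {Q : ProbabilityMeasure HolSpace}
    (hQ : IsRDESolution α L Q) (n : ℕ) :
    MeasurePreserving (markedIter α n)
      (Measure.infinitePi fun _ : List ℕ => L.toMeasure.prod (Q : Measure HolSpace)) Q := by
  induction n with
  | zero =>
    exact measurePreserving_snd.comp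
      (measurePreserving_eval_infinitePi (fun _ : List ℕ => L.toMeasure.prod (Q : Measure HolSpace))
        [])
  | succ n ih =>
    have h1 := measurePreserving_split
      fun _ : List ℕ => L.toMeasure.prod (Q : Measure HolSpace)
    have h2 : MeasurePreserving
        (fun (w : ℕ → List ℕ → ℕ × HolSpace) i => markedIter α n (w i))
        (Measure.infinitePi fun _ : ℕ =>
          Measure.infinitePi fun _ : List ℕ => L.toMeasure.prod (Q : Measure HolSpace))
        (Measure.infinitePi fun _ : ℕ => (Q : Measure HolSpace)) := by
      refine ⟨measurable_pi_lambda _ fun i => ih.measurable.comp (measurable_pi_apply i), ?_⟩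
      rw [Measure.infinitePi_map_pi _ fun _ => ih.measurable]
      simp_rw [ih.map_eq]
    have h3 : MeasurePreserving (fun p : ℕ × HolSpace => p.1)
        (L.toMeasure.prod (Q : Measure HolSpace)) L.toMeasure := measurePreserving_fst
    have h4 : MeasurePreserving (fun p : ℕ × (ℕ → HolSpace) => step (α * (p.1 + 1)) p.1 p.2)
        (inputLaw L Q) Q := ⟨measurable_step fun k => α * (k + 1), hQ.symm⟩
    have h5 := h4.comp ((h3.prod h2).comp h1)
    rw [show markedIter α (n + 1) = _ from funext (markedIter_succ α n)]
    exact h5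

theorem HolSpace.measure_ext {Q Q' : ProbabilityMeasure HolSpace}
    (h : ∀ I : Finset ℍ, (Q : Measure HolSpace).map (fun f (z : I) => f z)
      = (Q' : Measure HolSpace).map (fun f (z : I) => f z)) : Q = Q' := by
  have hm : Measurable HolSpace.toFun := comap_measurable _
  have h1 : (Q : Measure HolSpace).map HolSpace.toFun = (Q' : Measure HolSpace).map
      HolSpace.toFun := by
    have (R : ProbabilityMeasure HolSpace) :
        IsProbabilityMeasure ((R : Measure HolSpace).map HolSpace.toFun) :=
      Measure.isProbabilityMeasure_map hm.aemeasurable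
    refine IsProjectiveLimit.unique
      (P := fun I : Finset ℍ => (Q' : Measure HolSpace).map (fun f (z : I) => f z))
      (fun I => ?_) fun I => ?_
    · rw [Measure.map_map (by fun_prop) hm]
      exact h I
    · rw [Measure.map_map (by fun_prop) hm]
      rfl
  refine Subtype.ext (Measure.ext fun s hs => ?_)
  obtain ⟨t, ht, rfl⟩ := hs
  have h2 := congrArg (fun μ : Measure (ℍ → ℂ) => μ t) h1
  change Measure.map _ _ t = Measure.map _ _ t at h2
  rw [Measure.map_apply hm ht, Measure.map_apply hm ht] at h2
  exact h2

theorem IsRDESolution.eq_limitLaw {α : ℝ} {L : PMF ℕ}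
    (h : ∀ᵐ ν ∂gwLaw L, ∀ z, ForgetsAt α ν z) {Q : ProbabilityMeasure HolSpace}
    (hQ : IsRDESolution α L Q) : Q = limitLaw α L := by
  -- The argument passes to finitely many evaluations because convergence in distribution needs a
  -- topology, and `HolSpace` carries only a σ-algebra here.
  refine HolSpace.measure_ext fun I => ?_
  set K := Measure.infinitePi fun _ : List ℕ => L.toMeasure.prod (Q : Measure HolSpace)
  have hfst : MeasurePreserving (fun (m : List ℕ → ℕ × HolSpace) u => (m u).1) K (gwLaw L) := by
    refine ⟨by fun_prop, ?_⟩
    rw [Measure.infinitePi_map_pi (f := fun _ (p : ℕ × HolSpace) => p.1) _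
      fun _ => measurable_fst]
    simp_rw [measurePreserving_fst.map_eq]
    rfl
  have hev : Measurable fun (f : HolSpace) (z : I) => f z :=
    measurable_pi_lambda _ fun z => measurable_eval _
  have hlim : Measurable fun (m : List ℕ → ℕ × HolSpace) => gwLimit α fun u => (m u).1 :=
    (measurable_gwLimit α).comp hfst.measurable
  have h1 : TendstoInDistribution
      (fun (n : ℕ) (m : List ℕ → ℕ × HolSpace) (z : I) =>
        markedIter α n m z) atTop
      (fun m (z : I) => gwLimit α (fun u => (m u).1) z) (fun _ => K) K := by
    refine tendstoInDistribution_of_ae_tendsto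
      (fun n => (hev.comp (measurable_markedIter α n)).aemeasurable) (hev.comp hlim).aemeasurable ?_
    filter_upwards [hfst.quasiMeasurePreserving.ae h] with m hm
    rw [tendsto_pi_nhds]
    exact fun z => tendsto_iter hm (fun _ u => (m u).2) z
  have hid : ∀ n, IdentDistrib (fun (m : List ℕ → ℕ × HolSpace) (z : I) =>
      markedIter α n m z) (fun f (z : I) => f z) K
      (Q : Measure HolSpace) := fun n =>
    ⟨(hev.comp (measurable_markedIter α n)).aemeasurable, hev.aemeasurable, by
      rw [← (measurePreserving_markedIter hQ n).map_eq, Measure.map_map hev (measurable_markedIter α n)]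
      rfl⟩
  -- The same sequence has constant law `Q`, so uniqueness of limits in distribution identifies `Q`
  -- with the law of `gwLimit` on these evaluations.
  have h2 := tendstoInDistribution_of_identDistrib (l := atTop)
    (X := fun (n : ℕ) (m : List ℕ → ℕ × HolSpace) (z : I) => markedIter α n m z)
    (Z := fun (f : HolSpace) (z : I) => f z) (μ := fun _ => K) (μ' := (Q : Measure HolSpace)) 0
    (fun j => (hid 0).trans (hid j).symm) (hid 0)
  have h3 := tendstoInDistribution_unique _ h2 h1
  refine h3.trans ?_
  have h4 : (limitLaw α L : Measure HolSpace) = K.map fun m => gwLimit α fun u => (m u).1 := by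
    rw [limitLaw, ProbabilityMeasure.coe_mk, ← hfst.map_eq,
      Measure.map_map (measurable_gwLimit α) hfst.measurable]
    rfl
  rw [h4, Measure.map_map hev hlim]
  rfl

/-! ### The resolvent of the truncated tree -/

theorem append_singleton_mem_nodes {ν : List ℕ → ℕ} {n : ℕ} {v : List ℕ} (hv : v ∈ nodes ν n)
    {j : ℕ} : v ++ [j] ∈ nodes ν n ↔ v.length < n ∧ j < ν v := by
  constructor
  · intro h
    refine ⟨?_, h.2 v j (List.prefix_refl _)⟩
    have h1 := h.1
    rw [List.length_append, List.length_singleton] at h1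
    omega
  · rintro ⟨h1, h2⟩
    refine ⟨by rw [List.length_append, List.length_singleton]; omega, fun u i h => ?_⟩
    rcases List.prefix_concat_iff.1 h with h3 | h3
    · obtain ⟨rfl, h4⟩ := List.append_inj' h3 rfl
      rw [List.singleton_inj] at h4
      rwa [h4]
    · exact hv.2 u i h3

theorem mem_nodes_of_append {ν : List ℕ → ℕ} {n : ℕ} {u v : List ℕ} (h : u ++ v ∈ nodes ν n) :
    u ∈ nodes ν n := by
  refine ⟨?_, fun w i hw => h.2 w i (hw.trans (List.prefix_append u v))⟩
  have := h.1
  rw [List.length_append] at this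
  omega

-- The neighbours of a word are its parent, absent for the root, and its children, present only
-- below the last generation.
open scoped Classical in
theorem sum_neighborFinset_tree {E : Type*} [AddCommMonoid E] (ν : List ℕ → ℕ) (n : ℕ)
    (φ : List ℕ → E) (v : nodes ν n) :
    ∑ w ∈ (tree ν n).neighborFinset v, φ w
      = (if v.1 = [] then 0 else φ v.1.dropLast)
        + if v.1.length < n then ∑ i ∈ Finset.range (ν v), φ (v.1 ++ [i]) else 0 := by
  set A : Finset (List ℕ) := if v.1 = [] then ∅ else {v.1.dropLast} with hA
  set B : Finset (List ℕ) := if v.1.length < n then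
    (Finset.range (ν v)).image fun i => v.1 ++ [i] else ∅ with hB
  have hinj : Function.Injective fun i : ℕ => v.1 ++ [i] := fun i j h => by
    simpa using h
  have hdisj : Disjoint A B := by
    rw [Finset.disjoint_left]
    intro w hwA hwB
    rw [hA] at hwA
    rw [hB] at hwB
    split_ifs at hwA hwB with h1 h2
    · simp at hwA
    · simp at hwA
    · rw [Finset.mem_singleton] at hwA
      obtain ⟨i, -, hi⟩ := Finset.mem_image.1 hwB
      have h3 := congrArg List.length (hi.trans hwA)
      rw [List.length_append, List.length_dropLast, List.length_singleton] at h3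
      omega
    · simp at hwB
  have hmap : ((tree ν n).neighborFinset v).map (Function.Embedding.subtype _) = A ∪ B := by
    ext w
    rw [Finset.mem_map, Finset.mem_union]
    constructor
    · rintro ⟨w, hw, rfl⟩
      rw [SimpleGraph.mem_neighborFinset] at hw
      rcases hw with ⟨i, hi⟩ | ⟨i, hi⟩
      · have h1 := w.2
        rw [hi, append_singleton_mem_nodes v.2] at h1
        refine Or.inr ?_
        rw [hB, if_pos h1.1]
        exact Finset.mem_image.2 ⟨i, Finset.mem_range.2 h1.2, hi.symm⟩
      · refine Or.inl ?_
        rw [hA, if_neg (by rw [hi]; simp), Finset.mem_singleton, hi, List.dropLast_concat]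
        rfl
    · rintro (h | h)
      · rw [hA] at h
        split_ifs at h with h1
        · simp at h
        · rw [Finset.mem_singleton] at h
          have h2 := List.dropLast_append_getLast h1
          rw [← h] at h2
          exact ⟨⟨w, mem_nodes_of_append (h2 ▸ v.2)⟩,
            (SimpleGraph.mem_neighborFinset _ _ _).2 (Or.inr ⟨_, h2.symm⟩), rfl⟩
      · rw [hB] at h
        split_ifs at h with h1
        · obtain ⟨i, hi, rfl⟩ := Finset.mem_image.1 h
          exact ⟨⟨v.1 ++ [i], (append_singleton_mem_nodes v.2).2 ⟨h1, Finset.mem_range.1 hi⟩⟩,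
            (SimpleGraph.mem_neighborFinset _ _ _).2 (Or.inl ⟨i, rfl⟩), rfl⟩
        · simp at h
  have h1 : ∑ w ∈ (tree ν n).neighborFinset v, φ w
      = ∑ w ∈ ((tree ν n).neighborFinset v).map (Function.Embedding.subtype _), φ w := by
    rw [Finset.sum_map]
    rfl
  rw [h1, hmap, Finset.sum_union hdisj, hA, hB]
  congr 1
  · split_ifs <;> simp
  · split_ifs
    · exact Finset.sum_image hinj.injOn
    · simp

-- If `Hx = zx`, then `⟨x, Hx⟩ = z⟨x, x⟩` with both `⟨x, Hx⟩` and `⟨x, x⟩` real, so `x = 0`.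
open scoped ComplexOrder in
theorem isUnit_sub_smul_one {V : Type*} [Fintype V] [DecidableEq V] {H : Matrix V V ℂ}
    (hH : H.IsHermitian) {z : ℂ} (hz : z.im ≠ 0) : IsUnit (H - z • (1 : Matrix V V ℂ)) := by
  refine Matrix.mulVec_injective_iff_isUnit.1 ((injective_iff_map_eq_zero
    (Matrix.mulVecLin (H - z • (1 : Matrix V V ℂ)))).2 fun x hx => ?_)
  rw [Matrix.mulVecLin_apply, Matrix.sub_mulVec, Matrix.smul_mulVec, Matrix.one_mulVec,
    sub_eq_zero] at hx
  have h1 : (star x ⬝ᵥ H.mulVec x).im = 0 := hH.im_star_dotProduct_mulVec_self x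
  have h2 : (star x ⬝ᵥ x).im = 0 := by
    simpa using (Matrix.isHermitian_one (n := V) (α := ℂ)).im_star_dotProduct_mulVec_self x
  rw [hx, dotProduct_smul, smul_eq_mul, Complex.mul_im, h2, mul_zero, zero_add] at h1
  have h3 : (star x ⬝ᵥ x).re = 0 := (mul_eq_zero.1 h1).resolve_left hz
  exact dotProduct_star_self_eq_zero.1 (Complex.ext h3 h2)

open scoped Classical in
theorem isHermitian_treeMatrix (α : ℝ) (ν : List ℕ → ℕ) (n : ℕ) :
    (treeMatrix α ν n).IsHermitian := by
  refine (SimpleGraph.isHermitian_adjMatrix ℂ (tree ν n)).sub ?_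
  rw [Matrix.IsHermitian, Matrix.conjTranspose_smul,
    (SimpleGraph.isHermitian_degMatrix ℂ (tree ν n)).eq]
  congr 1
  exact Complex.conj_ofReal α

/-- The resolvent at the root is the root value of the solution of the resolvent equation. -/
theorem rootResolvent_eq {α : ℝ} {z : ℍ} {ν : List ℕ → ℕ} {n : ℕ} (g : List ℕ → ℂ)
    (hg : ∀ v ∈ nodes ν n,
      ((if v = [] then 0 else g v.dropLast)
        + if v.length < n then ∑ i ∈ Finset.range (ν v), g (v ++ [i]) else 0)
      - (α * ((if v = [] then 0 else 1) + if v.length < n then (ν v : ℂ) else 0) + z) * g v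
        = if v = [] then 1 else 0) :
    rootResolvent α z ν n = g [] := by
  classical
  set R := treeMatrix α ν n - (z : ℂ) • (1 : Matrix (nodes ν n) (nodes ν n) ℂ) with hR
  have hU : IsUnit R := isUnit_sub_smul_one (isHermitian_treeMatrix α ν n) z.im_pos.ne'
  have hdet : IsUnit R.det := (Matrix.isUnit_iff_isUnit_det R).1 hU
  have h1 : R.mulVec (fun v => g v) = Pi.single ⟨[], nil_mem_nodes ν n⟩ 1 := by
    funext v
    have hdeg : ((tree ν n).degree v : ℂ)
        = (if v.1 = [] then 0 else 1) + if v.1.length < n then (ν v : ℂ) else 0 := by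
      have h2 := sum_neighborFinset_tree ν n (fun _ => (1 : ℂ)) v
      simpa using h2
    rw [hR, treeMatrix, Matrix.sub_mulVec, Matrix.sub_mulVec, Matrix.smul_mulVec,
      Matrix.smul_mulVec, Matrix.one_mulVec, Pi.sub_apply, Pi.sub_apply, Pi.smul_apply,
      Pi.smul_apply, SimpleGraph.adjMatrix_mulVec_apply, SimpleGraph.degMatrix,
      Matrix.mulVec_diagonal, sum_neighborFinset_tree ν n g v, hdeg, Pi.single_apply]
    have h3 := hg v.1 v.2
    have h4 : (v = ⟨[], nil_mem_nodes ν n⟩) ↔ v.1 = [] := Subtype.ext_iff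
    simp only [h4, smul_eq_mul]
    rw [← h3]
    ring
  have h2 : (fun v : nodes ν n => g v) = R⁻¹.mulVec (Pi.single ⟨[], nil_mem_nodes ν n⟩ 1) := by
    rw [← h1, Matrix.mulVec_mulVec, Matrix.nonsing_inv_mul R hdet, Matrix.one_mulVec]
  rw [Matrix.mulVec_single_one] at h2
  have h3 := congrFun h2 ⟨[], nil_mem_nodes ν n⟩
  rw [rootResolvent]
  simp only [Matrix.col_apply] at h3
  rw [h3, hR]

theorem rootResolvent_zero (α : ℝ) (z : ℍ) (ν : List ℕ → ℕ) :
    rootResolvent α z ν 0 = -(z : ℂ)⁻¹ := by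
  refine rootResolvent_eq (fun _ => -(z : ℂ)⁻¹) fun v hv => ?_
  have h1 : v = [] := List.length_eq_zero_iff.1 (Nat.le_zero.1 hv.1)
  have h2 := z.ne_zero
  simp [h1, h2]

/-- The product of `-Y_u` over the vertices `u ≠ []` on the path from the root to a vertex, where
`Y_u` is the root value of the subtree of `u` in the tree stopped at generation `n`. -/
noncomputable def pathWeight (α : ℝ) (z : ℍ) : ℕ → (List ℕ → ℕ) → List ℕ → ℂ
  | _, _, [] => 1
  | n, ν, i :: w => -(truncated α (n - 1) (shift i ν) z) * pathWeight α z (n - 1) (shift i ν) w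

theorem pathWeight_append (α : ℝ) (z : ℍ) (n : ℕ) (ν : List ℕ → ℕ) (v : List ℕ) (i : ℕ) :
    pathWeight α z n ν (v ++ [i]) = pathWeight α z n ν v
      * -(truncated α (n - (v.length + 1)) (fun u => ν (v ++ i :: u)) z) := by
  induction v generalizing n ν with
  | nil =>
    simp only [List.nil_append, pathWeight, mul_one, one_mul, List.length_nil]
    rfl
  | cons j v ih =>
    rw [List.cons_append, pathWeight, pathWeight, ih, List.length_cons,
      show n - 1 - (v.length + 1) = n - (v.length + 1 + 1) by omega, mul_assoc]
    rfl

theorem inv_step_apply (a : ℝ) (n : ℕ) (h : ℕ → HolSpace) (z : ℍ) :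
    ((z : ℂ) + a + ∑ i ∈ Finset.range n, h i z) * step a n h z = -1 := by
  rw [step_apply, mul_neg, mul_inv_cancel₀ (denominator_ne_zero a n h z)]

/-- The root column of the resolvent is guessed as `X` times the path weight. At a vertex `v ≠ []`
the equation, divided by the value at the parent, is exactly the recursion for `Y_v`; at the root it
is the formula for `X`. -/
theorem rootResolvent_succ (α : ℝ) (z : ℍ) (ν : List ℕ → ℕ) (n : ℕ) :
    rootResolvent α z ν (n + 1)
      = step (α * ν []) (ν []) (fun i => truncated α n (shift i ν)) z := by
  set X := step (α * ν []) (ν []) (fun i => truncated α n (shift i ν)) z with hX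
  have hmain := rootResolvent_eq (α := α) (z := z) (ν := ν) (n := n + 1)
    (fun v => X * pathWeight α z (n + 1) ν v) ?_
  · rw [hmain, pathWeight, mul_one]
  intro v hv
  rcases List.eq_nil_or_concat' v with rfl | ⟨u, i, rfl⟩
  · have h1 := inv_step_apply (α * ν []) (ν []) (fun i => truncated α n (shift i ν)) z
    rw [← hX] at h1
    simp only [if_true, List.length_nil, Nat.succ_pos, zero_add, pathWeight,
      mul_one, List.nil_append, Nat.add_sub_cancel]
    rw [← Finset.mul_sum, Finset.sum_neg_distrib]
    rw [Complex.ofReal_mul, Complex.ofReal_natCast] at h1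
    linear_combination -h1
  · have hne : u ++ [i] ≠ [] := by simp
    have hlen : (u ++ [i]).length ≤ n + 1 := hv.1
    rw [List.length_append, List.length_singleton] at hlen
    simp only [if_neg hne, List.dropLast_concat, pathWeight_append, List.length_append,
      List.length_singleton]
    by_cases hlt : u.length + 1 < n + 1
    · obtain ⟨k, hk⟩ := Nat.exists_eq_add_of_lt hlt
      have h1 := inv_step_apply (α * (ν (u ++ [i]) + 1)) (ν (u ++ [i]))
        (fun j => truncated α k fun w => ν (u ++ i :: j :: w)) z
      have h2 : truncated α (k + 1) (fun w => ν (u ++ i :: w))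
          = step (α * (ν (u ++ [i]) + 1)) (ν (u ++ [i]))
            fun j => truncated α k fun w => ν (u ++ i :: j :: w) := rfl
      rw [← h2] at h1
      simp only [if_pos hlt, show n + 1 - (u.length + 1) = k + 1 by omega,
        show n + 1 - (u.length + 1 + 1) = k by omega, List.append_assoc, List.singleton_append]
      rw [← Finset.mul_sum, ← Finset.mul_sum, Finset.sum_neg_distrib]
      push_cast at h1
      linear_combination (X * pathWeight α z (n + 1) ν u) * h1
    -- A vertex of the last generation has its parent as only neighbour, hence degree `1` and value
    -- `-1/(z + α)`.
    · have h1 := inv_step_apply α 0 default z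
      simp only [if_neg hlt, show n + 1 - (u.length + 1) = 0 by omega]
      rw [Finset.sum_range_zero, add_zero] at h1
      change ((z : ℂ) + α) * leaf α z = -1 at h1
      change X * pathWeight α z (n + 1) ν u + 0
        - ((α : ℂ) * (1 + 0) + (z : ℂ)) * (X * (pathWeight α z (n + 1) ν u * -leaf α z)) = 0
      linear_combination (X * pathWeight α z (n + 1) ν u) * h1

/-! ### Convergence of the resolvent -/

theorem measurable_limitX (α : ℝ) (z : ℍ) : Measurable (limitX α z) :=
  (measurable_eval z).comp (measurable_step fun k => α * k)

theorem IsDegreeGW.hasLaw_split {Ω : Type*} [MeasurableSpace Ω] {P : Measure Ω} {Fs : PMF ℕ}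
    {h0 : mean Fs ≠ 0} {htop : mean Fs ≠ ∞} {ν : List ℕ → Ω → ℕ}
    (hν : IsDegreeGW P Fs h0 htop ν) :
    HasLaw (fun ω => (ν [] ω, fun i u => ν (i :: u) ω))
      (Fs.toMeasure.prod (Measure.infinitePi fun _ : ℕ => gwLaw (offspringLaw Fs h0 htop))) P := by
  let μ : List ℕ → Measure ℕ := fun u =>
    if u = [] then Fs.toMeasure else (offspringLaw Fs h0 htop).toMeasure
  have (u : List ℕ) : IsProbabilityMeasure (μ u) := by
    simp only [μ]
    split_ifs <;> infer_instance
  have hlaw : ∀ u, HasLaw (ν u) (μ u) P := fun u => by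
    by_cases hu : u = []
    · subst hu
      simpa only [μ, if_true] using hν.law_root
    · simpa only [μ, if_neg hu] using hν.law_node u hu
  have hpi : HasLaw (fun ω u => ν u ω) (Measure.infinitePi μ) P :=
    hν.indep.hasLaw_infinitePi hlaw (aemeasurable_pi_iff.2 fun u => (hlaw u).aemeasurable)
  have h1 := measurePreserving_split μ
  have h2 : (μ []).prod (Measure.infinitePi fun i => Measure.infinitePi fun u => μ (i :: u))
      = Fs.toMeasure.prod (Measure.infinitePi fun _ : ℕ => gwLaw (offspringLaw Fs h0 htop)) := by
    simp only [μ, if_true, List.cons_ne_nil, if_false]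
    rfl
  rw [h2] at h1
  exact HasLaw.comp ⟨h1.measurable.aemeasurable, h1.map_eq⟩ hpi

theorem tendstoInDistribution_rootResolvent {α : ℝ} {Fs : PMF ℕ} {h0 : mean Fs ≠ 0}
    {htop : mean Fs ≠ ∞} {Ω : Type*} [MeasurableSpace Ω] {P : Measure Ω} [IsProbabilityMeasure P]
    {ν : List ℕ → Ω → ℕ} (hν : IsDegreeGW P Fs h0 htop ν)
    (h : ∀ᵐ ν ∂gwLaw (offspringLaw Fs h0 htop), ∀ z, ForgetsAt α ν z) (z : ℍ) :
    TendstoInDistribution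
      (fun (n : ℕ) (ω : Ω) => rootResolvent α z (fun u => ν u ω) n) atTop
      (limitX α z) (fun _ => P) (inputLaw Fs (limitLaw α (offspringLaw Fs h0 htop))) := by
  have hsplit := hν.hasLaw_split
  have hinput := measurePreserving_inputLaw α (offspringLaw Fs h0 htop) Fs
  set T : Ω → ℕ × (ℕ → List ℕ → ℕ) := fun ω => (ν [] ω, fun i u => ν (i :: u) ω) with hT
  -- A copy of the limit built on the probability space of the tree, where the convergence is almost
  -- sure.
  set Z : Ω → ℂ := fun ω => limitX α z ((T ω).1, fun i => gwLimit α ((T ω).2 i)) with hZ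
  have hZlaw : IdentDistrib Z (limitX α z) P
      (inputLaw Fs (limitLaw α (offspringLaw Fs h0 htop))) := by
    have h1 : AEMeasurable (fun ω => ((T ω).1, fun i => gwLimit α ((T ω).2 i))) P :=
      hinput.measurable.comp_aemeasurable hsplit.aemeasurable
    refine ⟨(measurable_limitX α z).comp_aemeasurable h1,
      (measurable_limitX α z).aemeasurable, ?_⟩
    rw [← hinput.map_eq, ← hsplit.map_eq,
      AEMeasurable.map_map_of_aemeasurable hinput.measurable.aemeasurable hsplit.aemeasurable,
      AEMeasurable.map_map_of_aemeasurable (measurable_limitX α z).aemeasurable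
        (hinput.measurable.comp_aemeasurable hsplit.aemeasurable)]
    rfl
  have hmeas : ∀ n, AEMeasurable (fun ω => rootResolvent α z (fun u => ν u ω) n) P := by
    rintro (_ | n)
    · simp_rw [rootResolvent_zero]
      exact aemeasurable_const
    · have h1 : Measurable fun p : ℕ × (ℕ → List ℕ → ℕ) =>
          limitX α z (p.1, fun i => truncated α n (p.2 i)) :=
        (measurable_limitX α z).comp (measurable_fst.prodMk (measurable_pi_lambda _ fun i =>
          (measurable_truncated α n).comp ((measurable_pi_apply i).comp measurable_snd)))
      exact (h1.comp_aemeasurable hsplit.aemeasurable).congr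
        (Eventually.of_forall fun ω => (rootResolvent_succ α z (fun u => ν u ω) n).symm)
  have hae : ∀ᵐ ω ∂P, ∀ i z, ForgetsAt α ((T ω).2 i) z := by
    refine ae_all_iff.2 fun i => ?_
    have h1 : MeasurePreserving (fun p : ℕ × (ℕ → List ℕ → ℕ) => p.2 i)
        (Fs.toMeasure.prod (Measure.infinitePi fun _ : ℕ => gwLaw (offspringLaw Fs h0 htop)))
        (gwLaw (offspringLaw Fs h0 htop)) :=
      (measurePreserving_eval_infinitePi (fun _ : ℕ => gwLaw (offspringLaw Fs h0 htop)) i).comp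
        measurePreserving_snd
    have h2 := h1.quasiMeasurePreserving.ae h
    rw [← hsplit.map_eq] at h2
    exact ae_of_ae_map hsplit.aemeasurable h2
  have hconv : ∀ᵐ ω ∂P, Tendsto (fun n => rootResolvent α z (fun u => ν u ω) n) atTop
      (𝓝 (Z ω)) := by
    filter_upwards [hae] with ω hω
    -- The recursive formula for the resolvent starts at depth one.
    rw [← tendsto_add_atTop_iff_nat 1]
    simp_rw [rootResolvent_succ]
    exact (((tendsto_finsetSum _ fun i _ => tendsto_iter (hω i) (fun _ _ => leaf α) z).const_add
      _).inv₀ (denominator_ne_zero _ _ (fun i => gwLimit α ((T ω).2 i)) z)).neg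
  have hdist := tendstoInDistribution_of_ae_tendsto hmeas hZlaw.aemeasurable_fst hconv
  refine ⟨hmeas, hZlaw.aemeasurable_snd, ?_⟩
  convert! hdist.tendsto using 2
  exact congrArg 𝓝 (Subtype.ext hZlaw.map_eq.symm)

end GWResolvent

theorem mainTheorem3 (α : ℝ) (hα : α = 0 ∨ α = 1) (Fs : PMF ℕ)
    (h0 : GWResolvent.mean Fs ≠ 0) (htop : GWResolvent.mean Fs ≠ ∞)
    {Ω : Type*} [MeasurableSpace Ω] (P : Measure Ω) [IsProbabilityMeasure P]
    (ν : List ℕ → Ω → ℕ) (hν : GWResolvent.IsDegreeGW P Fs h0 htop ν) :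
    (∃! Q : ProbabilityMeasure GWResolvent.HolSpace,
      GWResolvent.IsRDESolution α (GWResolvent.offspringLaw Fs h0 htop) Q) ∧
    ∀ Q : ProbabilityMeasure GWResolvent.HolSpace,
      GWResolvent.IsRDESolution α (GWResolvent.offspringLaw Fs h0 htop) Q →
      ∀ z : ℍ,
        TendstoInDistribution
          (fun (n : ℕ) (ω : Ω) => GWResolvent.rootResolvent α z (fun u => ν u ω) n) atTop
          (GWResolvent.limitX α z) (fun _ => P) (GWResolvent.inputLaw Fs Q) := by
  have h := GWResolvent.ae_forgetsAt hα Fs h0 htop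
  refine ⟨⟨_, GWResolvent.isRDESolution_limitLaw h, fun Q hQ => hQ.eq_limitLaw h⟩,
    fun Q hQ z => ?_⟩
  obtain rfl := hQ.eq_limitLaw h
  exact GWResolvent.tendstoInDistribution_rootResolvent hν h z
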